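/- **Setting.** A *betweenness* on a set $X$ assigns to each pair $x,z\in X$ a set $\langle x,z\rangle\subset X$ such that for all $x,y,z\in X$: $\langle x,z\rangle=\langle z,x\rangle$; $x\in\langle x,z\rangle$; and if $y\in\langle x,z\rangle$, then $\langle x,y\rangle\cap\langle y,z\rangle=\{y\}$ and $\langle x,y\rangle\cup\langle y,z\rangle=\langle x,z\rangle$. On a metric space $(X,d)$ it is *compatible with the topology* if every $\langle x,z\rangle$ is compact and $(x,z)\mapsto\langle x,z\rangle$ is continuous from $X^2$ to the nonempty compact subsets of $X$ with the Hausdorff metric. Let $I\subset\mathbb R$ be a closed (possibly unbounded) interval of positive length and $\partial I=I\setminus\operatorname{int}(I)$. Let $\mathcal D_I(X)$ be the set of functions $f:I\to X$ that are right-continuous with left limits and satisfy $f(t-)=f(t)$ if $t=\sup I<\infty$. For $f\in\mathcal D_I(X)$ and $t\in I$ write $f(t+):=f(t)$, and let $f(t-)$ be the left limit at $t$, with $f(t-):=f(t)$ if $t=\inf I$. Let $I_{\mathfrak s}:=\{t-,t+:t\in I\}$ be ordered lexicographically (with $t-<t+$), and write $\underline\tau=t$ for $\tau=t\pm$. The *squeezed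 space* is $\mathcal R(X)=(X\times\mathbb R)\cup\{(\ast,-\infty),(\ast,\infty)\}$ with the metric $$d_{\rm sqz}\big((x,s),(y,t)\big)=\big(\phi(s)\wedge\phi(t)\big)\big(d(x,y)\wedge1\big)+|\phi(s)-\phi(t)|+|g(s)-g(t)|,$$ where $\phi(t)=\frac1{1+|t|}$, $g(t)=\frac t{1+|t|}$ for $t\in\mathbb R$, $\phi(\pm\infty)=0$, $g(\pm\infty)=\pm1$, and the first term is zero if one of the points is $(\ast,\pm\infty)$. The *filled-in graph* of $f\in\mathcal D_I(X)$ is $$\mathcal G_{\rm f}(f)=\{(x,t):t\in I,\ x\in\langle f(t-),f(t+)\rangle\}\cup\{(\ast,-\infty),(\ast,\infty)\},$$ ordered by $(x,s)\preceq(y,t)$ if $s<t$, or if $s=t\in\mathbb R$ and $x\in\langle f(t-),y\rangle$, or if $(x,s)=(y,t)$. The *Skorohod topology* on $\mathcal D_I(X)$ associated with the betweenness is generated by the metric that assigns to $f_1,f_2$ the Hausdorff distance, in $\mathcal R(X)^2$ with the maximum metric, between the sets $\{(p,q)\in\mathcal G_{\rm f}(f_i)^2:p\preceq q\}$, $i=1,2$.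 A set is *precompact* if its closure is compact. For $T,\delta>0$, the *Skorohod modulus of continuity* is $$m^{\rm S}_{T,\delta}(f)=\sup\big\{d\big(f(\tau_2),\langle f(\tau_1),f(\tau_3)\rangle\big):\tau_1,\tau_2,\tau_3\in I_{\mathfrak s},\ \tau_1\le\tau_2\le\tau_3,\ -T\le\underline\tau_1,\ \underline\tau_3\le T,\ \underline\tau_3-\underline\tau_1\le\delta\big\},$$ where $d(x,A)=\inf_{y\in A}d(x,y)$ and a supremum over the empty set is $0$. **Theorem.** Let $(X,d)$ be a metric space equipped with a betweenness that is compatible with the topology, and let $I$ be a closed real interval of positive length. A set $\mathcal F\subset\mathcal D_I(X)$ is precompact in the Skorohod topology on $\mathcal D_I(X)$ if and only if the following three conditions hold: 1. (compact containment) for every $T<\infty$ there is a compact set $C\subset X$ such that $f(t\pm)\in C$ for all $f\in\mathcal F$ and $t\in I\cap[-T,T]$; 2. $\displaystyle\lim_{\delta\to0}\sup_{f\in\mathcal F}m^{\rm S}_{T,\delta}(f)=0$ for all $0<T<\infty$; 3. $\displaystyle\lim_{\delta\to0}\sup_{f\in\mathcal F}\sup\{d(f(s),f(t)):s\in I,\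 |s-t|\le\delta\}=0$ for all $t\in\partial I$. -/

import Mathlib

open Set Filter Topology
open scoped ENNReal

/-- A betweenness on a set `X`: every pair `x, z` is assigned a segment `seg x z`. -/
structure Betweenness (X : Type*) where
  seg : X → X → Set X
  seg_comm : ∀ x z, seg x z = seg z x
  left_mem : ∀ x z, x ∈ seg x z
  inter_eq : ∀ x y z, y ∈ seg x z → seg x y ∩ seg y z = {y}
  union_eq : ∀ x y z, y ∈ seg x z → seg x y ∪ seg y z = seg x z

/-- A betweenness on a metric space is compatible with the topology if all segments are compact
and `(x, z) ↦ ⟨x, z⟩` is continuous from `X × X` to the nonempty compact subsets of `X`, with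
the topology of the Hausdorff metric. -/
structure Betweenness.IsCompatible {X : Type*} [MetricSpace X] (B : Betweenness X) : Prop where
  isCompact_seg : ∀ x z, IsCompact (B.seg x z)
  continuous_seg : Continuous fun p : X × X =>
    ({ carrier := B.seg p.1 p.2
       isCompact' := isCompact_seg p.1 p.2
       nonempty' := ⟨p.1, B.left_mem p.1 p.2⟩ } : TopologicalSpace.NonemptyCompacts X)

/-- The space of cadlag functions `f : I → X` that have no jump at `sup I`, if `sup I < ∞`. -/
@[ext]
structure Cadlag (I : Set ℝ) (X : Type*) [TopologicalSpace X] where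
  toFun : I → X
  right_continuous : ∀ t : I, Tendsto toFun (𝓝[>] t) (𝓝 (toFun t))
  left_limit : ∀ t : I, ∃ l : X, Tendsto toFun (𝓝[<] t) (𝓝 l)
  left_limit_max : ∀ t : I, IsMax t → Tendsto toFun (𝓝[<] t) (𝓝 (toFun t))

namespace Cadlag

variable {I : Set ℝ} {X : Type*} [TopologicalSpace X]

/-- The value `f(t-)`. At the left endpoint of `I`, where there is no left limit,
`Function.leftLim` is the value of the function itself, so that there `f(t-) = f(t)`. -/
noncomputable def left (f : Cadlag I X) (t : I) : X := Function.leftLim f.toFun t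

/-- A cadlag function as a function on the split interval `{t-, t+ : t ∈ I}`. The split interval is
`I ×ₗ Bool` with its lexicographic order; `(t, false)` stands for `t-` and `(t, true)` for `t+`. -/
noncomputable def split (f : Cadlag I X) (τ : I ×ₗ Bool) : X :=
  if (ofLex τ).2 then f.toFun (ofLex τ).1 else f.left (ofLex τ).1

end Cadlag

/-- The real part of a point of the split interval. -/
def splitReal {I : Set ℝ} (τ : I ×ₗ Bool) : ℝ := ((ofLex τ).1 : ℝ)

/-- The squeezed space of `X`: the product `X × ℝ` together with the two points
`(∗, -∞)` and `(∗, ∞)`. -/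
inductive Squeezed (X : Type*) where
  | point (x : X) (t : ℝ) : Squeezed X
  | negInf : Squeezed X
  | posInf : Squeezed X

namespace Squeezed

variable {X : Type*}

/-- The time coordinate. -/
noncomputable def time : Squeezed X → EReal
  | point _ t => (t : EReal)
  | negInf => ⊥
  | posInf => ⊤

/-- The time coordinate under the order homeomorphism `t ↦ t / (1 + |t|)` from the extended real
line to `[-1, 1]`; its pullback metric generates the topology of the extended real line. -/
noncomputable def scaledTime : Squeezed X → ℝ
  | point _ t => t / (1 + |t|)
  | negInf => -1
  | posInf => 1

/-- The weight `φ(t) = 1 / (1 + |t|)` of the time coordinate `t`, with `φ(±∞) = 0`. -/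
noncomputable def weight : Squeezed X → ℝ
  | point _ t => 1 / (1 + |t|)
  | negInf => 0
  | posInf => 0

/-- The truncated distance of the space coordinates (zero if one of the points is at infinity). -/
noncomputable def spaceDist [MetricSpace X] : Squeezed X → Squeezed X → ℝ
  | point x _, point y _ => min (dist x y) 1
  | _, _ => 0

/-- The metric of the squeezed space. -/
noncomputable def sqzDist [MetricSpace X] (p q : Squeezed X) : ℝ :=
  min p.weight q.weight * spaceDist p q + |p.weight - q.weight| + |p.scaledTime - q.scaledTime|

theorem weight_nonneg (p : Squeezed X) : 0 ≤ p.weight := by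
  cases p <;> simp only [weight] <;> positivity

theorem spaceDist_nonneg [MetricSpace X] (p q : Squeezed X) : 0 ≤ spaceDist p q := by
  cases p <;> cases q <;> simp [spaceDist]

theorem spaceDist_le_one [MetricSpace X] (p q : Squeezed X) : spaceDist p q ≤ 1 := by
  cases p <;> cases q <;> simp [spaceDist]

theorem spaceDist_comm [MetricSpace X] (p q : Squeezed X) : spaceDist p q = spaceDist q p := by
  cases p <;> cases q <;> simp [spaceDist, dist_comm]

theorem sqzDist_triangle [MetricSpace X] (p q r : Squeezed X) :
    sqzDist p r ≤ sqzDist p q + sqzDist q r := by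
  have key : min p.weight r.weight * spaceDist p r + |p.weight - r.weight| ≤
      (min p.weight q.weight * spaceDist p q + |p.weight - q.weight|) +
      (min q.weight r.weight * spaceDist q r + |q.weight - r.weight|) := by
    have hp := weight_nonneg p
    have hq := weight_nonneg q
    have hr := weight_nonneg r
    have e1 := spaceDist_nonneg p q
    have e2 := spaceDist_nonneg q r
    have e3 := spaceDist_nonneg p r
    have o := spaceDist_le_one p r
    have htri : q.weight ≠ 0 → spaceDist p r ≤ spaceDist p q + spaceDist q r := by
      intro h
      cases q with
      | point y u =>
        cases p with
        | point x s =>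
          cases r with
          | point z t =>
            simp only [spaceDist]
            have := dist_triangle x y z
            have h1 := dist_nonneg (x := x) (y := y)
            have h2 := dist_nonneg (x := y) (y := z)
            rcases min_cases (dist x z) 1 with h3 | h3 <;>
            rcases min_cases (dist x y) 1 with h4 | h4 <;>
            rcases min_cases (dist y z) 1 with h5 | h5 <;> linarith
          | negInf => simp [spaceDist]
          | posInf => simp [spaceDist]
        | negInf => simpa [spaceDist] using e2
        | posInf => simpa [spaceDist] using e2
      | negInf => exact absurd rfl h
      | posInf => exact absurd rfl h
    generalize p.weight = a at *
    generalize q.weight = b at *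
    generalize r.weight = c at *
    generalize spaceDist p q = D1 at *
    generalize spaceDist q r = D2 at *
    generalize spaceDist p r = D at *
    have m1 : 0 ≤ min a b := le_min hp hq
    have m2 : 0 ≤ min b c := le_min hq hr
    have m3 : 0 ≤ min a c := le_min hp hr
    have tri : |a - c| ≤ |a - b| + |b - c| := abs_sub_le a b c
    rcases le_or_gt (min a c) b with h | h
    · have g1 : min a c ≤ min a b := le_min (min_le_left _ _) h
      have g2 : min a c ≤ min b c := le_min h (min_le_right _ _)
      have f1 := mul_le_mul_of_nonneg_right g1 e1
      have f2 := mul_le_mul_of_nonneg_right g2 e2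
      rcases eq_or_ne b 0 with hb | hb
      · have : min a c = 0 := le_antisymm (by rw [← hb]; exact h) m3
        rw [this, zero_mul]
        have := mul_nonneg m1 e1
        have := mul_nonneg m2 e2
        linarith
      · have := mul_le_mul_of_nonneg_left (htri hb) m3
        rw [mul_add] at this
        linarith
    · have ha : b < a := lt_of_lt_of_le h (min_le_left _ _)
      have hc : b < c := lt_of_lt_of_le h (min_le_right _ _)
      rw [min_eq_right ha.le, min_eq_left hc.le]
      rw [abs_of_pos (sub_pos.2 ha), abs_of_neg (sub_neg.2 hc)]
      rcases eq_or_ne b 0 with hb | hb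
      · have h1 : min a c * D ≤ min a c := mul_le_of_le_one_right m3 o
        have h2 := min_le_left a c
        have h3 := min_le_right a c
        subst hb
        rcases abs_cases (a - c) with h4 | h4 <;> simp only [zero_mul] <;> linarith
      · have h0 := mul_le_mul_of_nonneg_left (htri hb) hq
        have h1 : (min a c - b) * D ≤ min a c - b :=
          mul_le_of_le_one_right (by linarith) o
        have h2 := min_le_left a c
        have h3 := min_le_right a c
        rcases abs_cases (a - c) with h4 | h4 <;> nlinarith
  have t := abs_sub_le p.scaledTime q.scaledTime r.scaledTime
  simp only [sqzDist]
  linarith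

theorem abs_scaled_lt_one (t : ℝ) : |t / (1 + |t|)| < 1 := by
  have h : 0 < 1 + |t| := by positivity
  rw [abs_div, abs_of_pos h, div_lt_one h]
  linarith

theorem scaled_injective {s t : ℝ} (h : s / (1 + |s|) = t / (1 + |t|))
    (hw : 1 / (1 + |s|) = 1 / (1 + |t|)) : s = t := by
  have hs : 0 < 1 + |s| := by positivity
  have h1 : s * (1 / (1 + |s|)) = t * (1 / (1 + |s|)) := by
    nth_rewrite 2 [hw]
    rw [mul_one_div, mul_one_div, h]
  exact mul_right_cancel₀ (one_div_pos.2 hs).ne' h1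

theorem eq_of_sqzDist_eq_zero [MetricSpace X] {p q : Squeezed X} (h : sqzDist p q = 0) :
    p = q := by
  have h1 : 0 ≤ min p.weight q.weight * spaceDist p q :=
    mul_nonneg (le_min (weight_nonneg p) (weight_nonneg q)) (spaceDist_nonneg p q)
  have h2 := abs_nonneg (p.weight - q.weight)
  have h3 := abs_nonneg (p.scaledTime - q.scaledTime)
  simp only [sqzDist] at h
  have a1 : min p.weight q.weight * spaceDist p q = 0 := by linarith
  have a2 : p.weight = q.weight := sub_eq_zero.1 (abs_eq_zero.1 (by linarith))
  have a3 : p.scaledTime = q.scaledTime := sub_eq_zero.1 (abs_eq_zero.1 (by linarith))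
  have wpos : ∀ t : ℝ, (1 : ℝ) / (1 + |t|) ≠ 0 := fun t => by positivity
  cases p with
  | point x s =>
    cases q with
    | point y t =>
      simp only [weight, scaledTime, spaceDist] at a1 a2 a3
      have hst : s = t := scaled_injective a3 a2
      subst hst
      rw [min_self] at a1
      have hm : min (dist x y) 1 = 0 := (mul_eq_zero.1 a1).resolve_left (wpos s)
      have hd : dist x y = 0 := by
        rcases min_cases (dist x y) 1 with h4 | h4 <;> linarith
      rw [dist_eq_zero.1 hd]
    | negInf => exact absurd a2 (wpos s)
    | posInf => exact absurd a2 (wpos s)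
  | negInf =>
    cases q with
    | point y t => exact absurd a2.symm (wpos t)
    | negInf => rfl
    | posInf => simp only [scaledTime] at a3; norm_num at a3
  | posInf =>
    cases q with
    | point y t => exact absurd a2.symm (wpos t)
    | negInf => simp only [scaledTime] at a3; norm_num at a3
    | posInf => rfl

noncomputable instance [MetricSpace X] : MetricSpace (Squeezed X) where
  dist := sqzDist
  dist_self p := by
    cases p <;> simp [sqzDist, spaceDist]
  dist_comm p q := by
    simp only [sqzDist]
    rw [min_comm, spaceDist_comm, abs_sub_comm p.weight, abs_sub_comm p.scaledTime]
  dist_triangle := sqzDist_triangle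
  eq_of_dist_eq_zero := eq_of_sqzDist_eq_zero

end Squeezed

namespace Betweenness

variable {X : Type*} [MetricSpace X]

/-- The filled-in graph of a cadlag function. -/
def filledGraph (B : Betweenness X) {I : Set ℝ} (f : Cadlag I X) : Set (Squeezed X) :=
  {p | ∃ (t : I) (x : X), x ∈ B.seg (f.left t) (f.toFun t) ∧ p = Squeezed.point x t} ∪
    {Squeezed.negInf, Squeezed.posInf}

/-- The order `p ≼ q` of the filled-in graph: earlier points come first, and points `(x, t)`,
`(y, t)` with the same real time are ordered by the order of the segment from `f(t-)` to `f(t+)`,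
that is, `x` precedes `y` if `x` lies between `f(t-)` and `y`. -/
def graphLE (B : Betweenness X) {I : Set ℝ} (f : Cadlag I X) (p q : Squeezed X) : Prop :=
  p.time < q.time ∨ p = q ∨
    ∃ (t : I) (x y : X), p = Squeezed.point x t ∧ q = Squeezed.point y t ∧
      x ∈ B.seg (f.left t) y

/-- The filled-in graph `G` as an ordered set, given by `{(p, q) ∈ G × G : p ≼ q}`. -/
def orderedGraph (B : Betweenness X) {I : Set ℝ} (f : Cadlag I X) :
    Set (Squeezed X × Squeezed X) :=
  {pq | pq.1 ∈ B.filledGraph f ∧ pq.2 ∈ B.filledGraph f ∧ B.graphLE f pq.1 pq.2}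

/-- The Skorohod metric: the Hausdorff distance between the ordered filled-in graphs,
where `Squeezed X × Squeezed X` carries the maximum metric. -/
@[reducible]
noncomputable def skorohodMetric (B : Betweenness X) (I : Set ℝ) :
    PseudoEMetricSpace (Cadlag I X) where
  edist f g := Metric.hausdorffEDist (B.orderedGraph f) (B.orderedGraph g)
  edist_self _ := Metric.hausdorffEDist_self
  edist_comm _ _ := Metric.hausdorffEDist_comm
  edist_triangle _ _ _ := Metric.hausdorffEDist_triangle

/-- The Skorohod topology on cadlag functions associated with a betweenness. -/
@[reducible]
noncomputable def skorohodTopology (B : Betweenness X) (I : Set ℝ) :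
    TopologicalSpace (Cadlag I X) :=
  (B.skorohodMetric I).toUniformSpace.toTopologicalSpace

/-- A set of cadlag functions is precompact if its closure in the Skorohod topology is compact. -/
def IsPrecompact (B : Betweenness X) {I : Set ℝ} (F : Set (Cadlag I X)) : Prop :=
  @IsCompact _ (B.skorohodTopology I) (@closure _ (B.skorohodTopology I) F)

/-- The Skorohod modulus of continuity. -/
noncomputable def skorohodModulus (B : Betweenness X) {I : Set ℝ} (T δ : ℝ) (f : Cadlag I X) :
    ℝ≥0∞ :=
  ⨆ (τ₁ : I ×ₗ Bool) (τ₂ : I ×ₗ Bool) (τ₃ : I ×ₗ Bool)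
    (_ : τ₁ ≤ τ₂ ∧ τ₂ ≤ τ₃ ∧ -T ≤ splitReal τ₁ ∧ splitReal τ₃ ≤ T ∧
      splitReal τ₃ - splitReal τ₁ ≤ δ),
    Metric.infEDist (f.split τ₂) (B.seg (f.split τ₁) (f.split τ₃))

end Betweenness

/-- The compact containment condition. -/
def CompactContainment {X : Type*} [MetricSpace X] {I : Set ℝ} (F : Set (Cadlag I X)) : Prop :=
  ∀ T : ℝ, ∃ C : Set X, IsCompact C ∧
    ∀ f ∈ F, ∀ τ : I ×ₗ Bool, |splitReal τ| ≤ T → f.split τ ∈ C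

/-! ### Hausdorff limits, iterated limits and ultrafilters. -/

section HausdorffLimits

variable {α ι : Type*} [PseudoEMetricSpace α]

/-! Convergence is tested along ultrafilters, and the central notion is `SplitLimit`: whenever
ordered split times of the `g i` converge to a common `s`, the values there converge to ordered
points of the segment from `f(s-)` to `f(s+)`. It says that the ordered graphs of the `g i`
accumulate only on that of `f`. Applied to a constant family it shows that ordered graphs are
compact (`isCompact_orderedGraph`).

Necessity: if the closure of `F` is compact, every family in it converges along every ultrafilter,
and Hausdorff convergence to a compact ordered graph yields `SplitLimit` (`splitLimit_of_tendsto`).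
A failure of condition 2 would give three ordered times merging at some `s`. The three limit values
are ordered on one segment, so the middle one lies between the outer two, and continuity of segments
gives a contradiction. At an endpoint of `I` the segment is a single point, whence condition 3.
Compact containment follows because the segments of all graphs in the closure over bounded times
form a compact set.

Sufficiency: compact containment gives a pointwise limit `H` along the ultrafilter. The modulus
forces one-sided limits of `H`, since a second cluster value `y` would lie between `x` and `x`; the
right limits of `H` form the candidate `f` (`exists_cadlag_of_pointwise_limit`). Comparison with
times slightly before and after `s` gives `SplitLimit` (`splitLimit_of_pointwise_limit`), which is
one half of the Hausdorff convergence. For the other half, each `y` between `f(s-)` and `f(s+)` must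
be approximated by filled-in graphs. A crossing argument finds a time at which `g i` passes from the
part of the segment before `y` to the part after it, possibly by a jump, whose filled-in segment
then comes close to `y` (`tendsto_infEDist_filledGraph_point`). -/

theorem IsCompact.exists_tendsto_of_infEDist {A : Set α} (hA : IsCompact A) (hne : A.Nonempty)
    (W : Ultrafilter ι) {z : ι → α}
    (hz : Tendsto (fun i => Metric.infEDist (z i) A) W (𝓝 0)) :
    ∃ a ∈ A, Tendsto z W (𝓝 a) := by
  choose w hwA hw using fun i => hA.exists_infEDist_eq_edist hne (z i)
  obtain ⟨a, haA, ha⟩ := isCompact_iff_ultrafilter_le_nhds'.1 hA (W.map w)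
    (Ultrafilter.mem_map.2 (univ_mem' hwA))
  refine ⟨a, haA, ?_⟩
  have ha' : Tendsto w W (𝓝 a) := ha
  rw [tendsto_iff_edist_tendsto_0] at ha' ⊢
  have hsum := hz.add ha'
  rw [add_zero] at hsum
  refine tendsto_of_tendsto_of_tendsto_of_le_of_le tendsto_const_nhds hsum (fun _ => zero_le) ?_
  intro i
  simp only [hw]
  exact edist_triangle _ _ _

theorem exists_tendsto_of_infEDist_of_isCompact {K : ι → Set α} (hK : ∀ i, IsCompact (K i))
    (hne : ∀ i, (K i).Nonempty) {W : Filter ι} {z : α}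
    (hz : Tendsto (fun i => Metric.infEDist z (K i)) W (𝓝 0)) :
    ∃ w : ι → α, (∀ i, w i ∈ K i) ∧ Tendsto w W (𝓝 z) := by
  choose w hwK hw using fun i => (hK i).exists_infEDist_eq_edist (hne i) z
  refine ⟨w, hwK, ?_⟩
  rw [tendsto_iff_edist_tendsto_0]
  simpa only [hw, edist_comm] using hz

theorem mem_of_tendsto_hausdorffEDist {A : Set α} (hA : IsClosed A) {K : ι → Set α}
    {W : Filter ι} [W.NeBot] {z : ι → α} {a : α} (hz : Tendsto z W (𝓝 a))
    (hzK : ∀ᶠ i in W, z i ∈ K i)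
    (hK : Tendsto (fun i => Metric.hausdorffEDist (K i) A) W (𝓝 0)) : a ∈ A := by
  rw [Metric.mem_iff_infEDist_zero_of_closed hA]
  rw [tendsto_iff_edist_tendsto_0] at hz
  have hsum := hz.add hK
  rw [add_zero] at hsum
  refine le_antisymm (ge_of_tendsto hsum ?_) zero_le
  filter_upwards [hzK] with i hi
  rw [edist_comm]
  exact (Metric.infEDist_le_edist_add_infEDist).trans
    (add_le_add le_rfl (Metric.infEDist_le_hausdorffEDist_of_mem hi))

end HausdorffLimits

/-- An iterated limit becomes a limit along a single filter. The curried filter fixes the outer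
variable before the inner one; the product filter would require uniformity in the outer variable. -/
theorem Filter.Tendsto.curry_nhds {α β γ : Type*} [TopologicalSpace γ] {l : Filter α}
    {m : Filter β} {g : α → β → γ} {h : α → γ} {x : γ}
    (hg : ∀ a, Tendsto (g a) m (𝓝 (h a))) (hh : Tendsto h l (𝓝 x)) :
    Tendsto (fun p : α × β => g p.1 p.2) (l.curry m) (𝓝 x) := by
  rw [(nhds_basis_opens x).tendsto_right_iff]
  rintro O ⟨hxO, hO⟩
  rw [eventually_curry_iff]
  filter_upwards [hh (hO.mem_nhds hxO)] with a ha
  exact hg a (hO.mem_nhds ha)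

theorem Filter.tendsto_snd_curry {α β : Type*} (l : Filter α) (m : Filter β) :
    Tendsto Prod.snd (l.curry m) m := tendsto_snd.mono_left curry_le_prod

theorem Filter.tendsto_fst_curry {α β : Type*} (l : Filter α) (m : Filter β) :
    Tendsto Prod.fst (l.curry m) l := tendsto_fst.mono_left curry_le_prod

/-- A real-valued function along an ultrafilter converges in the extended real line. -/
theorem Ultrafilter.tendsto_real_trichotomy {ι : Type*} (W : Ultrafilter ι) (t : ι → ℝ) :
    (∃ s, Tendsto t W (𝓝 s)) ∨ Tendsto t W atTop ∨ Tendsto t W atBot := by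
  by_cases h1 : Tendsto t W atTop
  · exact Or.inr (Or.inl h1)
  by_cases h2 : Tendsto t W atBot
  · exact Or.inr (Or.inr h2)
  left
  rw [tendsto_atTop] at h1
  rw [tendsto_atBot] at h2
  push Not at h1 h2
  obtain ⟨b, hb⟩ := h1
  obtain ⟨a, ha⟩ := h2
  obtain ⟨s, -, hs⟩ := isCompact_iff_ultrafilter_le_nhds'.1 (isCompact_Icc (a := a) (b := b))
    (W.map t) (by
      change ∀ᶠ i in W, t i ∈ Icc a b
      filter_upwards [hb, ha] with i h1 h2
      exact ⟨h2.le, h1.le⟩)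
  exact ⟨s, hs⟩

/-! ### The order on a segment, and limits of segments. -/

namespace Betweenness

section Order

variable {X : Type*} (B : Betweenness X)

theorem right_mem (x z : X) : z ∈ B.seg x z := by
  rw [B.seg_comm]; exact B.left_mem z x

theorem seg_self (a : X) : B.seg a a = {a} := by
  simpa using B.inter_eq a a a (B.left_mem a a)

variable {B} {a b x y z : X}

theorem seg_subset_left (h : x ∈ B.seg a y) : B.seg a x ⊆ B.seg a y := by
  rw [← B.union_eq a x y h]; exact subset_union_left

theorem seg_subset_right (h : x ∈ B.seg a y) : B.seg x y ⊆ B.seg a y := by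
  rw [← B.union_eq a x y h]; exact subset_union_right

theorem seg_trans (h : x ∈ B.seg a y) (h' : y ∈ B.seg a z) : x ∈ B.seg a z :=
  seg_subset_left h' h

theorem eq_of_mem_seg_of_mem_seg (h : x ∈ B.seg a y) (h' : y ∈ B.seg a x) : x = y := by
  have := B.inter_eq a x y h
  have hy : y ∈ B.seg a x ∩ B.seg x y := ⟨h', B.right_mem x y⟩
  rw [this] at hy
  exact hy.symm

/-- The point `x` cuts the segment from `a` to `z` in two. If `y` were in the part before `x`,
antisymmetry would give `y = x`. -/
theorem mem_seg_of_le_of_le (h : x ∈ B.seg a y) (h' : y ∈ B.seg a z) : y ∈ B.seg x z := by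
  have hx := seg_trans h h'
  have hy : y ∈ B.seg a x ∪ B.seg x z := by rw [B.union_eq a x z hx]; exact h'
  rcases hy with hy | hy
  · rw [eq_of_mem_seg_of_mem_seg h hy]; exact B.left_mem _ _
  · exact hy

/-- If `b` precedes `z` and `y` lies between `b` and `z`, then `b` precedes `y`. -/
theorem mem_seg_of_mem_seg_right (h : b ∈ B.seg a z) (h' : y ∈ B.seg b z) : b ∈ B.seg a y := by
  rw [B.seg_comm] at h h' ⊢
  exact mem_seg_of_le_of_le h' h

/-- Totality of the order: if each point lies on the `b`-side of the other, antisymmetry as seen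
from `b` makes them equal. -/
theorem mem_seg_or_mem_seg (hx : x ∈ B.seg a b) (hy : y ∈ B.seg a b) :
    x ∈ B.seg a y ∨ y ∈ B.seg a x := by
  have h1 : x ∈ B.seg a y ∪ B.seg y b := by rw [B.union_eq a y b hy]; exact hx
  have h2 : y ∈ B.seg a x ∪ B.seg x b := by rw [B.union_eq a x b hx]; exact hy
  rcases h1 with h1 | h1
  · exact Or.inl h1
  rcases h2 with h2 | h2
  · exact Or.inr h2
  left
  rw [B.seg_comm] at h1 h2
  rw [eq_of_mem_seg_of_mem_seg h1 h2]
  exact B.right_mem _ _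

theorem mem_seg_of_mem_seg_end (hy : y ∈ B.seg a b) (hx : x ∈ B.seg y b) : y ∈ B.seg a x :=
  mem_seg_of_mem_seg_right hy hx

end Order

section Limits

variable {X : Type*} [MetricSpace X] {B : Betweenness X} {ι : Type*}

theorem IsCompatible.tendsto_hausdorffEDist (hB : B.IsCompatible) {W : Filter ι} {a b : ι → X}
    {a' b' : X} (ha : Tendsto a W (𝓝 a')) (hb : Tendsto b W (𝓝 b')) :
    Tendsto (fun i => Metric.hausdorffEDist (B.seg (a i) (b i)) (B.seg a' b')) W (𝓝 0) := by
  have h := (hB.continuous_seg.tendsto (a', b')).comp (ha.prodMk_nhds hb)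
  rw [tendsto_iff_edist_tendsto_0] at h
  exact h

theorem IsCompatible.mem_seg_of_tendsto (hB : B.IsCompatible) {W : Filter ι} [W.NeBot]
    {x a b : ι → X} {x' a' b' : X} (hx : Tendsto x W (𝓝 x')) (ha : Tendsto a W (𝓝 a'))
    (hb : Tendsto b W (𝓝 b')) (h : ∀ᶠ i in W, x i ∈ B.seg (a i) (b i)) : x' ∈ B.seg a' b' :=
  mem_of_tendsto_hausdorffEDist (hB.isCompact_seg a' b').isClosed hx h
    (hB.tendsto_hausdorffEDist ha hb)

theorem IsCompatible.exists_tendsto_mem_seg (hB : B.IsCompatible) (W : Ultrafilter ι)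
    {x a b : ι → X} {a' b' : X} (ha : Tendsto a W (𝓝 a'))
    (hb : Tendsto b W (𝓝 b')) (h : ∀ᶠ i in (W : Filter ι), x i ∈ B.seg (a i) (b i)) :
    ∃ x' ∈ B.seg a' b', Tendsto x W (𝓝 x') := by
  refine (hB.isCompact_seg a' b').exists_tendsto_of_infEDist ⟨a', B.left_mem _ _⟩ W ?_
  refine tendsto_of_tendsto_of_tendsto_of_le_of_le' tendsto_const_nhds
    (hB.tendsto_hausdorffEDist ha hb) (Eventually.of_forall fun _ => zero_le) ?_
  filter_upwards [h] with i hi using Metric.infEDist_le_hausdorffEDist_of_mem hi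

theorem IsCompatible.exists_mem_seg_tendsto (hB : B.IsCompatible) {W : Filter ι}
    {a b : ι → X} {x' a' b' : X} (ha : Tendsto a W (𝓝 a'))
    (hb : Tendsto b W (𝓝 b')) (h : x' ∈ B.seg a' b') :
    ∃ x : ι → X, (∀ i, x i ∈ B.seg (a i) (b i)) ∧ Tendsto x W (𝓝 x') := by
  refine exists_tendsto_of_infEDist_of_isCompact (fun i => hB.isCompact_seg _ _)
    (fun i => ⟨a i, B.left_mem _ _⟩) ?_
  refine tendsto_of_tendsto_of_tendsto_of_le_of_le tendsto_const_nhds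
    (hB.tendsto_hausdorffEDist ha hb) (fun _ => zero_le) ?_
  intro i
  dsimp only
  rw [Metric.hausdorffEDist_comm]
  exact Metric.infEDist_le_hausdorffEDist_of_mem h

/-- The distance to a varying segment vanishes in the limit only for points of the limit
segment. -/
theorem IsCompatible.mem_seg_of_infEDist_le (hB : B.IsCompatible) {W : Filter ι} [W.NeBot]
    {x a b : ι → X} {x' a' b' : X} (hx : Tendsto x W (𝓝 x')) (ha : Tendsto a W (𝓝 a'))
    (hb : Tendsto b W (𝓝 b'))
    (h : ∀ ε : ℝ≥0∞, 0 < ε → ∀ᶠ i in W, Metric.infEDist (x i) (B.seg (a i) (b i)) ≤ ε) :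
    x' ∈ B.seg a' b' := by
  rw [Metric.mem_iff_infEDist_zero_of_closed (hB.isCompact_seg a' b').isClosed]
  refine le_antisymm (le_of_forall_pos_le_add fun ε hε => ?_) zero_le
  rw [zero_add]
  rw [tendsto_iff_edist_tendsto_0] at hx
  have hsum := (hx.add (hB.tendsto_hausdorffEDist ha hb)).add_const ε
  rw [add_zero, zero_add] at hsum
  refine ge_of_tendsto hsum ?_
  filter_upwards [h ε hε] with i hi
  calc Metric.infEDist x' (B.seg a' b')
      ≤ edist x' (x i) + Metric.infEDist (x i) (B.seg a' b') :=
        Metric.infEDist_le_edist_add_infEDist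
    _ ≤ edist (x i) x' + (Metric.infEDist (x i) (B.seg (a i) (b i)) +
          Metric.hausdorffEDist (B.seg (a i) (b i)) (B.seg a' b')) := by
        rw [edist_comm]
        exact add_le_add le_rfl Metric.infEDist_le_infEDist_add_hausdorffEDist
    _ ≤ edist (x i) x' + (ε + Metric.hausdorffEDist (B.seg (a i) (b i)) (B.seg a' b')) := by
        gcongr
    _ = _ := by rw [add_comm ε, add_assoc]

end Limits

end Betweenness

/-! ### Convergence in the squeezed space. -/

namespace Squeezed

variable {X : Type*} [MetricSpace X] {ι : Type*}

theorem dist_def (p q : Squeezed X) : dist p q =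
    min p.weight q.weight * spaceDist p q + |p.weight - q.weight| + |p.scaledTime - q.scaledTime| :=
  rfl

theorem continuous_weight : Continuous (weight : Squeezed X → ℝ) := by
  refine (LipschitzWith.of_dist_le_mul (K := 1) fun p q => ?_).continuous
  rw [Real.dist_eq, dist_def, NNReal.coe_one, one_mul]
  have h1 := mul_nonneg (le_min (weight_nonneg p) (weight_nonneg q)) (spaceDist_nonneg p q)
  have h2 := abs_nonneg (p.scaledTime - q.scaledTime)
  linarith

theorem continuous_scaledTime : Continuous (scaledTime : Squeezed X → ℝ) := by
  refine (LipschitzWith.of_dist_le_mul (K := 1) fun p q => ?_).continuous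
  rw [Real.dist_eq, dist_def, NNReal.coe_one, one_mul]
  have h1 := mul_nonneg (le_min (weight_nonneg p) (weight_nonneg q)) (spaceDist_nonneg p q)
  have h2 := abs_nonneg (p.weight - q.weight)
  linarith

omit [MetricSpace X] in
theorem weight_point_pos (x : X) (t : ℝ) : 0 < (point x t).weight := by
  simp only [weight]; positivity

theorem tendsto_point {l : Filter ι} {x : ι → X} {t : ι → ℝ} {a : X} {s : ℝ}
    (hx : Tendsto x l (𝓝 a)) (ht : Tendsto t l (𝓝 s)) :
    Tendsto (fun i => point (x i) (t i)) l (𝓝 (point a s)) := by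
  rw [tendsto_iff_dist_tendsto_zero] at hx ⊢
  have hw : Tendsto (fun i => |1 / (1 + |t i|) - 1 / (1 + |s|)|) l (𝓝 0) := by
    have h : Continuous fun r : ℝ => |1 / (1 + |r|) - 1 / (1 + |s|)| := by
      refine ((continuous_const.div (by fun_prop) fun r => ?_).sub continuous_const).abs
      positivity
    simpa [Function.comp_def] using (h.tendsto s).comp ht
  have hs : Tendsto (fun i => |t i / (1 + |t i|) - s / (1 + |s|)|) l (𝓝 0) := by
    have h : Continuous fun r : ℝ => |r / (1 + |r|) - s / (1 + |s|)| := by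
      refine ((continuous_id.div (by fun_prop) fun r => ?_).sub continuous_const).abs
      positivity
    simpa [Function.comp_def] using (h.tendsto s).comp ht
  have hsum := (hx.add hw).add hs
  simp only [add_zero] at hsum
  refine squeeze_zero (fun _ => dist_nonneg) (fun i => ?_) hsum
  rw [dist_def]
  refine add_le_add (add_le_add ?_ le_rfl) le_rfl
  · have h0 := weight_nonneg (point (x i) (t i))
    have h1 : (point (x i) (t i)).weight ≤ 1 := by
      simp only [weight]
      rw [div_le_one (by positivity)]
      linarith [abs_nonneg (t i)]
    calc _ ≤ 1 * spaceDist (point (x i) (t i)) (point a s) := by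
          gcongr
          · exact spaceDist_nonneg _ _
          · exact (min_le_left _ _).trans h1
      _ ≤ _ := by rw [one_mul]; exact min_le_left _ _

/-- The time is the quotient of the continuous functions `scaledTime` and `weight`, and the weight
of the limit is nonzero. -/
theorem time_of_tendsto_point {l : Filter ι} {x : ι → X} {t : ι → ℝ} {a : X} {s : ℝ}
    (h : Tendsto (fun i => point (x i) (t i)) l (𝓝 (point a s))) : Tendsto t l (𝓝 s) := by
  have h1 := (continuous_weight.tendsto _).comp h
  have h2 := (continuous_scaledTime.tendsto _).comp h
  have h3 := h2.div h1 (weight_point_pos a s).ne'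
  have key : ∀ r : ℝ, (r / (1 + |r|)) / (1 / (1 + |r|)) = r := fun r => by
    have : 0 < 1 + |r| := by positivity
    field_simp
  simpa only [Function.comp_def, Pi.div_def, weight, scaledTime, key] using h3

/-- Near a real point the weights stay away from zero, so the factor in front of the space term can
be divided out. The truncation at 1 is eventually inactive. -/
theorem space_of_tendsto_point {l : Filter ι} {x : ι → X} {t : ι → ℝ} {a : X} {s : ℝ}
    (h : Tendsto (fun i => point (x i) (t i)) l (𝓝 (point a s))) : Tendsto x l (𝓝 a) := by
  have h1 := ((continuous_weight.tendsto _).comp h).min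
    (tendsto_const_nhds (x := (point a s).weight))
  rw [min_self] at h1
  have h2 := tendsto_iff_dist_tendsto_zero.1 h
  have h3 : Tendsto (fun i => min (point (x i) (t i)).weight (point a s).weight *
      min (dist (x i) a) 1) l (𝓝 0) := by
    refine squeeze_zero (fun i => ?_) (fun i => ?_) h2
    · exact mul_nonneg (le_min (weight_nonneg _) (weight_nonneg _))
        (le_min dist_nonneg zero_le_one)
    · rw [dist_def]
      have h1 := abs_nonneg ((point (x i) (t i)).weight - (point a s).weight)
      have h2 := abs_nonneg ((point (x i) (t i)).scaledTime - (point a s).scaledTime)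
      simp only [spaceDist]
      linarith
  have h4 := h3.div h1 (weight_point_pos a s).ne'
  rw [zero_div] at h4
  have h5 : Tendsto (fun i => min (dist (x i) a) 1) l (𝓝 0) := by
    refine h4.congr fun i => ?_
    have : 0 < min (point (x i) (t i)).weight (point a s).weight :=
      lt_min (weight_point_pos _ _) (weight_point_pos _ _)
    simp only [Pi.div_apply, Function.comp_def]
    field_simp
  rw [tendsto_iff_dist_tendsto_zero]
  refine h5.congr' ?_
  filter_upwards [h5.eventually (gt_mem_nhds one_pos)] with i hi
  rcases min_lt_iff.1 hi with h | h
  · exact min_eq_left h.le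
  · exact absurd h (lt_irrefl _)

theorem tendsto_posInf {l : Filter ι} {x : ι → X} {t : ι → ℝ} (ht : Tendsto t l atTop) :
    Tendsto (fun i => point (x i) (t i)) l (𝓝 posInf) := by
  rw [tendsto_iff_dist_tendsto_zero]
  have h1 : Tendsto (fun i => 2 * (1 + t i)⁻¹) l (𝓝 (2 * 0)) :=
    (tendsto_inv_atTop_zero.comp (tendsto_atTop_add_const_left _ 1 ht)).const_mul 2
  rw [mul_zero] at h1
  refine h1.congr' ?_
  filter_upwards [ht.eventually_ge_atTop 0] with i hi
  have h2 : 0 < 1 + t i := by linarith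
  rw [dist_def]
  simp only [weight, scaledTime, spaceDist, abs_of_nonneg hi]
  have h3 : t i / (1 + t i) - 1 = -(1 / (1 + t i)) := by field_simp; ring
  rw [h3, abs_neg, sub_zero, abs_of_pos (by positivity)]
  ring

theorem tendsto_negInf {l : Filter ι} {x : ι → X} {t : ι → ℝ} (ht : Tendsto t l atBot) :
    Tendsto (fun i => point (x i) (t i)) l (𝓝 negInf) := by
  rw [tendsto_iff_dist_tendsto_zero]
  have h1 : Tendsto (fun i => 2 * (1 + -t i)⁻¹) l (𝓝 (2 * 0)) :=
    (tendsto_inv_atTop_zero.comp (tendsto_atTop_add_const_left _ 1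
      (tendsto_neg_atBot_atTop.comp ht))).const_mul 2
  rw [mul_zero] at h1
  refine h1.congr' ?_
  filter_upwards [ht.eventually_le_atBot 0] with i hi
  have h2 : 0 < 1 + -t i := by linarith
  rw [dist_def]
  simp only [weight, scaledTime, spaceDist, abs_of_nonpos hi]
  have h3 : t i / (1 + -t i) - -1 = 1 / (1 + -t i) := by field_simp; ring
  rw [h3, sub_zero, abs_of_pos (by positivity)]
  ring

theorem scaled_strictMono : StrictMono fun t : ℝ => t / (1 + |t|) := by
  intro s t h
  have hs : 0 < 1 + |s| := by positivity
  have ht : 0 < 1 + |t| := by positivity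
  simp only
  rw [div_lt_div_iff₀ hs ht]
  rcases abs_cases s with h1 | h1 <;> rcases abs_cases t with h2 | h2 <;> rw [h1.1, h2.1] <;>
    nlinarith

omit [MetricSpace X] in
-- This allows the time order to be passed to limits through the continuous real coordinate
-- `scaledTime`.
theorem time_lt_iff (p q : Squeezed X) : p.time < q.time ↔ p.scaledTime < q.scaledTime := by
  have h1 := fun t : ℝ => (abs_lt.1 (abs_scaled_lt_one t))
  cases p with
  | point x s =>
    cases q with
    | point y t => simpa [time, scaledTime] using scaled_strictMono.lt_iff_lt.symm
    | negInf => simpa [time, scaledTime] using (h1 s).1.le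
    | posInf => simpa [time, scaledTime] using (h1 s).2
  | negInf =>
    cases q with
    | point y t => simpa [time, scaledTime] using (h1 t).1
    | negInf => simp [time]
    | posInf => simp [time, scaledTime]
  | posInf =>
    cases q with
    | point y t => simpa [time, scaledTime] using (h1 t).2.le
    | negInf => simp [time, scaledTime]
    | posInf => simp [time]

/-- Limits of points whose times stay bounded are points at a finite time. -/
theorem exists_eq_point_of_tendsto {l : Filter ι} [l.NeBot] {x : ι → X} {t : ι → ℝ} {T : ℝ}
    (ht : ∀ᶠ i in l, |t i| ≤ T) {p : Squeezed X}
    (h : Tendsto (fun i => point (x i) (t i)) l (𝓝 p)) :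
    ∃ a s, p = point a s ∧ Tendsto x l (𝓝 a) ∧ Tendsto t l (𝓝 s) := by
  have hw : 0 < p.weight := by
    obtain ⟨i, hi⟩ := ht.exists
    have hT : 0 < 1 + T := by linarith [abs_nonneg (t i)]
    refine lt_of_lt_of_le (one_div_pos.2 hT)
      (ge_of_tendsto ((continuous_weight.tendsto _).comp h) ?_)
    filter_upwards [ht] with i hi
    simp only [Function.comp_def, weight]
    gcongr
  cases p with
  | point a s => exact ⟨a, s, rfl, space_of_tendsto_point h, time_of_tendsto_point h⟩
  | negInf => exact absurd hw (lt_irrefl _)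
  | posInf => exact absurd hw (lt_irrefl _)

end Squeezed

/-! ### The split interval, and cadlag functions near a time. -/

section Split

variable {I : Set ℝ}

theorem splitReal_mono {τ σ : I ×ₗ Bool} (h : τ ≤ σ) : splitReal τ ≤ splitReal σ := by
  rcases Prod.Lex.le_iff.1 h with h | h
  · exact h.le
  · exact (congrArg Subtype.val h.1).le

theorem le_of_splitReal_lt {τ σ : I ×ₗ Bool} (h : splitReal τ < splitReal σ) : τ ≤ σ :=
  Prod.Lex.le_iff.2 (Or.inl h)

theorem toLex_false_le_toLex_true (t : I) : (toLex (t, false) : I ×ₗ Bool) ≤ toLex (t, true) :=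
  Prod.Lex.le_iff.2 (Or.inr ⟨rfl, Bool.false_le _⟩)

theorem le_false_or_true_le (τ : I ×ₗ Bool) (s : I) :
    τ ≤ toLex (s, false) ∨ toLex (s, true) ≤ τ := by
  rcases lt_trichotomy (ofLex τ).1 s with h | h | h
  · exact Or.inl (Prod.Lex.le_iff.2 (Or.inl h))
  · cases hb : (ofLex τ).2
    · exact Or.inl (Prod.Lex.le_iff.2 (Or.inr ⟨h, by simp [hb]⟩))
    · exact Or.inr (Prod.Lex.le_iff.2 (Or.inr ⟨h.symm, by simp [hb]⟩))
  · exact Or.inr (Prod.Lex.le_iff.2 (Or.inl h))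

end Split

namespace Cadlag

variable {I : Set ℝ} {X : Type*}

variable [MetricSpace X] [I.OrdConnected]

theorem tendsto_left (f : Cadlag I X) (t : I) : Tendsto f.toFun (𝓝[<] t) (𝓝 (f.left t)) :=
  tendsto_leftLim_of_tendsto (f.left_limit t)

theorem left_eq_of_nhdsLT_eq_bot (f : Cadlag I X) {t : I} (h : 𝓝[<] t = ⊥) :
    f.left t = f.toFun t := leftLim_eq_of_eq_bot _ h

omit [I.OrdConnected] in
theorem left_eq_of_isMin (f : Cadlag I X) {t : I} (h : IsMin t) : f.left t = f.toFun t :=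
  leftLim_eq_of_isBot h.isBot

theorem left_eq_of_isMax (f : Cadlag I X) {t : I} (h : IsMax t) : f.left t = f.toFun t := by
  rcases eq_or_neBot (𝓝[<] t) with h' | h'
  · exact f.left_eq_of_nhdsLT_eq_bot h'
  · exact tendsto_nhds_unique (f.tendsto_left t) (f.left_limit_max t h)

/-- A closed set that contains the values of `f` at all times of a one-sided neighbourhood contains
the left limit. -/
theorem left_mem_of_isClosed (f : Cadlag I X) {S : Set X} (hS : IsClosed S) {t : I}
    (h : ∀ᶠ r in 𝓝[≤] t, f.toFun r ∈ S) : f.left t ∈ S := by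
  rcases eq_or_neBot (𝓝[<] t) with h' | h'
  · rw [f.left_eq_of_nhdsLT_eq_bot h']
    exact h.self_of_nhdsWithin self_mem_Iic
  · exact hS.mem_of_tendsto (f.tendsto_left t)
      (h.filter_mono (nhdsWithin_mono _ Iio_subset_Iic_self))

theorem tendsto_left_nhdsLE (f : Cadlag I X) (s : I) :
    Tendsto f.left (𝓝[≤] s) (𝓝 (f.left s)) :=
  continuousWithinAt_leftLim_Iic (f.tendsto_left s)

/-- For `t > s` near `s`, all values of `f` close to `t` lie in a given closed neighbourhood of
`f(s)`, and this passes to the left limit at `t`. -/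
theorem tendsto_left_nhdsGT (f : Cadlag I X) (s : I) :
    Tendsto f.left (𝓝[>] s) (𝓝 (f.toFun s)) := by
  refine (closed_nhds_basis (f.toFun s)).tendsto_right_iff.2 ?_
  rintro S ⟨hSs, hS⟩
  have h1 : ∀ᶠ r in 𝓝[>] s, f.toFun r ∈ S := f.right_continuous s hSs
  have h2 := eventually_eventually_nhdsWithin.2 h1
  filter_upwards [h2, self_mem_nhdsWithin] with t ht hst
  refine f.left_mem_of_isClosed hS ?_
  rw [(isOpen_Ioi : IsOpen (Ioi s)).nhdsWithin_eq hst] at ht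
  exact ht.filter_mono nhdsWithin_le_nhds

theorem tendsto_split_of_le {ι : Type*} {W : Filter ι} (f : Cadlag I X) {s : I}
    {τ : ι → I ×ₗ Bool} (hτ : Tendsto (fun i => splitReal (τ i)) W (𝓝 (s : ℝ)))
    (h : ∀ᶠ i in W, τ i ≤ toLex (s, false)) :
    Tendsto (fun i => f.split (τ i)) W (𝓝 (f.left s)) := by
  have ht : Tendsto (fun i => (ofLex (τ i)).1) W (𝓝 s) := tendsto_subtype_rng.2 hτ
  intro S hS
  have h1 := ht.eventually (eventually_nhdsWithin_iff.1 (f.tendsto_left_nhdsLE s hS))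
  have h2 := ht.eventually (eventually_nhdsWithin_iff.1 (f.tendsto_left s hS))
  change ∀ᶠ i in W, f.split (τ i) ∈ S
  filter_upwards [h, h1, h2] with i hi h1 h2
  simp only [split] at *
  rcases Prod.Lex.le_iff.1 hi with h3 | h3
  · split_ifs with hb
    · exact h2 h3
    · exact h1 (le_of_lt h3)
  · have hb : (ofLex (τ i)).2 = false := Bool.eq_false_of_le_false h3.2
    rw [if_neg (by simp [hb])]
    exact h1 (le_of_eq h3.1)

theorem tendsto_split_of_ge {ι : Type*} {W : Filter ι} (f : Cadlag I X) {s : I}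
    {τ : ι → I ×ₗ Bool} (hτ : Tendsto (fun i => splitReal (τ i)) W (𝓝 (s : ℝ)))
    (h : ∀ᶠ i in W, toLex (s, true) ≤ τ i) :
    Tendsto (fun i => f.split (τ i)) W (𝓝 (f.toFun s)) := by
  have ht : Tendsto (fun i => (ofLex (τ i)).1) W (𝓝 s) := tendsto_subtype_rng.2 hτ
  intro S hS
  have h1 := ht.eventually (eventually_nhdsWithin_iff.1 (f.tendsto_left_nhdsGT s hS))
  have h2 := ht.eventually (eventually_nhdsWithin_iff.1 (f.right_continuous s hS))
  change ∀ᶠ i in W, f.split (τ i) ∈ S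
  filter_upwards [h, h1, h2] with i hi h1 h2
  simp only [split] at *
  rcases Prod.Lex.le_iff.1 hi with h3 | h3
  · split_ifs with hb
    · exact h2 h3
    · exact h1 h3
  · have hb : (ofLex (τ i)).2 = true := Bool.eq_true_of_true_le h3.2
    rw [if_pos hb, ← show s = (ofLex (τ i)).1 from h3.1]
    exact mem_of_mem_nhds hS

end Cadlag

/-! ### Split limits and compactness of ordered graphs. -/

namespace Betweenness

variable {I : Set ℝ} {X ι : Type*} [MetricSpace X] {B : Betweenness X}

/-- The values of `g i` at ordered split times converging to a common time `s` converge to ordered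
points of the segment from `f(s-)` to `f(s+)`. -/
def SplitLimit (B : Betweenness X) (W : Ultrafilter ι) (g : ι → Cadlag I X) (f : Cadlag I X) :
    Prop :=
  ∀ (τ σ : ι → I ×ₗ Bool) (s : I), (∀ᶠ i in (W : Filter ι), τ i ≤ σ i) →
    Tendsto (fun i => splitReal (τ i)) W (𝓝 (s : ℝ)) →
    Tendsto (fun i => splitReal (σ i)) W (𝓝 (s : ℝ)) →
    ∃ x y, Tendsto (fun i => (g i).split (τ i)) W (𝓝 x) ∧
      Tendsto (fun i => (g i).split (σ i)) W (𝓝 y) ∧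
      x ∈ B.seg (f.left s) y ∧ y ∈ B.seg (f.left s) (f.toFun s)

/-- The ultrafilter decides whether split times stay at or before `s-` or at or after `s+`; the
value tends to `f(s-)` or `f(s+)` accordingly. -/
theorem splitLimit_const [I.OrdConnected] (B : Betweenness X) (W : Ultrafilter ι)
    (f : Cadlag I X) : B.SplitLimit W (fun _ => f) f := by
  intro τ σ s hτσ hτ hσ
  have hcases : ∀ ρ : ι → I ×ₗ Bool, (∀ᶠ i in (W : Filter ι), ρ i ≤ toLex (s, false)) ∨
      ∀ᶠ i in (W : Filter ι), toLex (s, true) ≤ ρ i := fun ρ =>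
    Ultrafilter.eventually_or.1 (Eventually.of_forall fun i => le_false_or_true_le (ρ i) s)
  rcases hcases τ with h1 | h1
  · rcases hcases σ with h2 | h2
    · exact ⟨_, _, f.tendsto_split_of_le hτ h1, f.tendsto_split_of_le hσ h2, B.left_mem _ _,
        B.left_mem _ _⟩
    · exact ⟨_, _, f.tendsto_split_of_le hτ h1, f.tendsto_split_of_ge hσ h2, B.left_mem _ _,
        B.right_mem _ _⟩
  · have h2 : ∀ᶠ i in (W : Filter ι), toLex (s, true) ≤ σ i := by
      filter_upwards [h1, hτσ] with i h3 h4 using h3.trans h4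
    exact ⟨_, _, f.tendsto_split_of_ge hτ h1, f.tendsto_split_of_ge hσ h2, B.right_mem _ _,
      B.right_mem _ _⟩

theorem negInf_mem_filledGraph (B : Betweenness X) (f : Cadlag I X) :
    Squeezed.negInf ∈ B.filledGraph f := Or.inr (Or.inl rfl)

theorem posInf_mem_filledGraph (B : Betweenness X) (f : Cadlag I X) :
    Squeezed.posInf ∈ B.filledGraph f := Or.inr (Or.inr rfl)

theorem point_mem_filledGraph_iff {f : Cadlag I X} {x : X} {t : I} :
    Squeezed.point x (t : ℝ) ∈ B.filledGraph f ↔ x ∈ B.seg (f.left t) (f.toFun t) := by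
  constructor
  · rintro (⟨s, y, hy, h⟩ | h)
    · injection h with h1 h2
      rw [h1, Subtype.ext h2]
      exact hy
    · rcases h with h | h <;> cases h
  · intro h
    exact Or.inl ⟨t, x, h, rfl⟩

theorem split_mem_seg (B : Betweenness X) (f : Cadlag I X) (τ : I ×ₗ Bool) :
    f.split τ ∈ B.seg (f.left (ofLex τ).1) (f.toFun (ofLex τ).1) := by
  unfold Cadlag.split
  split_ifs
  · exact B.right_mem _ _
  · exact B.left_mem _ _

theorem split_mem_filledGraph (B : Betweenness X) (f : Cadlag I X) (τ : I ×ₗ Bool) :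
    Squeezed.point (f.split τ) (splitReal τ) ∈ B.filledGraph f :=
  point_mem_filledGraph_iff.2 (B.split_mem_seg f τ)

theorem graphLE_total {f : Cadlag I X} {p q : Squeezed X} (hp : p ∈ B.filledGraph f)
    (hq : q ∈ B.filledGraph f) : B.graphLE f p q ∨ B.graphLE f q p := by
  rcases lt_trichotomy p.time q.time with h | h | h
  · exact Or.inl (Or.inl h)
  · rcases hp with ⟨s, x, hx, rfl⟩ | hp
    · rcases hq with ⟨t, y, hy, rfl⟩ | hq
      · simp only [Squeezed.time, EReal.coe_eq_coe_iff] at h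
        obtain rfl := Subtype.ext h
        rcases mem_seg_or_mem_seg hx hy with h1 | h1
        · exact Or.inl (Or.inr (Or.inr ⟨s, x, y, rfl, rfl, h1⟩))
        · exact Or.inr (Or.inr (Or.inr ⟨s, y, x, rfl, rfl, h1⟩))
      · rcases hq with rfl | rfl <;> simp [Squeezed.time] at h
    · rcases hq with ⟨t, y, hy, rfl⟩ | hq
      · rcases hp with rfl | rfl <;> simp [Squeezed.time] at h
      · rcases hp with rfl | rfl <;> rcases hq with rfl | rfl
        · exact Or.inl (Or.inr (Or.inl rfl))
        · simp [Squeezed.time] at h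
        · simp [Squeezed.time] at h
        · exact Or.inl (Or.inr (Or.inl rfl))
  · exact Or.inr (Or.inl h)

theorem graphLE_point_iff {f : Cadlag I X} {x y : X} {s : I} :
    B.graphLE f (.point x s) (.point y s) ↔ x = y ∨ x ∈ B.seg (f.left s) y := by
  constructor
  · rintro (h | h | ⟨t, a, b, h1, h2, h3⟩)
    · exact absurd h (lt_irrefl _)
    · injection h with h
      exact Or.inl h
    · injection h1 with h1 h1'
      injection h2 with h2 h2'
      rw [h1, h2, Subtype.ext h1']
      exact Or.inr h3
  · rintro (rfl | h)
    · exact Or.inr (Or.inl rfl)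
    · exact Or.inr (Or.inr ⟨s, x, y, rfl, rfl, h⟩)

theorem graphLE_antisymm {f : Cadlag I X} {p q : Squeezed X} (h : B.graphLE f p q)
    (h' : B.graphLE f q p) : p = q := by
  rcases h with h | h | ⟨s, x, y, rfl, rfl, h⟩
  · rcases h' with h' | h' | ⟨s, x, y, rfl, rfl, -⟩
    · exact absurd h h'.asymm
    · exact h'.symm
    · exact absurd h (lt_irrefl _)
  · exact h
  · rcases graphLE_point_iff.1 h' with h' | h'
    · rw [h']
    · rw [eq_of_mem_seg_of_mem_seg h h']

/-- Real points of filled-in graphs whose times converge converge to the limit segment. -/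
theorem SplitLimit.exists_tendsto_space (hB : B.IsCompatible) {W : Ultrafilter ι}
    {g : ι → Cadlag I X} {f : Cadlag I X} (h : B.SplitLimit W g f) {t : ι → I} {x : ι → X} {s : I}
    (hx : ∀ᶠ i in (W : Filter ι), x i ∈ B.seg ((g i).left (t i)) ((g i).toFun (t i)))
    (ht : Tendsto (fun i => (t i : ℝ)) W (𝓝 (s : ℝ))) :
    ∃ a b y, Tendsto (fun i => (g i).left (t i)) W (𝓝 a) ∧
      Tendsto (fun i => (g i).toFun (t i)) W (𝓝 b) ∧ Tendsto x W (𝓝 y) ∧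
      a ∈ B.seg (f.left s) b ∧ b ∈ B.seg (f.left s) (f.toFun s) ∧ y ∈ B.seg a b := by
  obtain ⟨a, b, ha, hb, hab, hbs⟩ := h (fun i => toLex (t i, false)) (fun i => toLex (t i, true)) s
    (Eventually.of_forall fun i => toLex_false_le_toLex_true _) ht ht
  obtain ⟨y, hy, hxy⟩ := hB.exists_tendsto_mem_seg W ha hb hx
  exact ⟨a, b, y, ha, hb, hxy, hab, hbs, hy⟩

theorem SplitLimit.exists_tendsto_filledGraph (hI : IsClosed I) (hB : B.IsCompatible)
    {W : Ultrafilter ι} {g : ι → Cadlag I X} {f : Cadlag I X} (h : B.SplitLimit W g f)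
    {p : ι → Squeezed X} (hp : ∀ i, p i ∈ B.filledGraph (g i)) :
    ∃ q ∈ B.filledGraph f, Tendsto p W (𝓝 q) := by
  by_cases hneg : ∀ᶠ i in (W : Filter ι), p i = Squeezed.negInf
  · exact ⟨_, B.negInf_mem_filledGraph f, tendsto_const_nhds.congr' (hneg.mono fun i hi => hi.symm)⟩
  by_cases hpos : ∀ᶠ i in (W : Filter ι), p i = Squeezed.posInf
  · exact ⟨_, B.posInf_mem_filledGraph f, tendsto_const_nhds.congr' (hpos.mono fun i hi => hi.symm)⟩
  have hreal : ∀ᶠ i in (W : Filter ι), ∃ (t : I) (x : X),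
      x ∈ B.seg ((g i).left t) ((g i).toFun t) ∧ p i = Squeezed.point x t := by
    filter_upwards [Ultrafilter.eventually_not.2 hneg, Ultrafilter.eventually_not.2 hpos]
      with i h1 h2
    rcases hp i with h3 | h3 | h3
    · exact h3
    · exact absurd h3 h1
    · exact absurd h3 h2
  obtain ⟨i₀, t₀, x₀, -⟩ := hreal.exists
  have : Nonempty I := ⟨t₀⟩
  have : Nonempty X := ⟨x₀⟩
  obtain ⟨t, ht⟩ := hreal.choice
  obtain ⟨x, hx⟩ := ht.choice
  have hpx : (fun i => Squeezed.point (x i) (t i : ℝ)) =ᶠ[W] p := hx.mono fun i hi => hi.2.symm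
  rcases W.tendsto_real_trichotomy (fun i => (t i : ℝ)) with ⟨s, hs⟩ | hs | hs
  · have hsI : s ∈ I := hI.mem_of_tendsto hs (Eventually.of_forall fun i => (t i).2)
    obtain ⟨a, b, y, -, -, hxy, hab, hb, hy⟩ :=
      h.exists_tendsto_space hB (s := ⟨s, hsI⟩) (hx.mono fun i hi => hi.1) hs
    exact ⟨.point y s, point_mem_filledGraph_iff (t := ⟨s, hsI⟩).2
      (seg_subset_left hb (seg_subset_right hab hy)), (Squeezed.tendsto_point hxy hs).congr' hpx⟩
  · exact ⟨_, B.posInf_mem_filledGraph f, (Squeezed.tendsto_posInf hs).congr' hpx⟩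
  · exact ⟨_, B.negInf_mem_filledGraph f, (Squeezed.tendsto_negInf hs).congr' hpx⟩

/-- If points of filled-in graphs converge to a real point, they are eventually real. -/
theorem exists_real_of_tendsto {W : Ultrafilter ι} {g : ι → Cadlag I X} {p : ι → Squeezed X}
    (hp : ∀ i, p i ∈ B.filledGraph (g i)) {y : X} {s : I} (h : Tendsto p W (𝓝 (.point y s))) :
    ∃ (t : ι → I) (x : ι → X), (∀ᶠ i in (W : Filter ι),
      x i ∈ B.seg ((g i).left (t i)) ((g i).toFun (t i)) ∧ p i = Squeezed.point (x i) (t i)) ∧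
      Tendsto (fun i => (t i : ℝ)) W (𝓝 (s : ℝ)) ∧ Tendsto x W (𝓝 y) := by
  have hreal : ∀ᶠ i in (W : Filter ι), ∃ (t : I) (x : X),
      x ∈ B.seg ((g i).left t) ((g i).toFun t) ∧ p i = Squeezed.point x t := by
    have hw := ((Squeezed.continuous_weight.tendsto _).comp h).eventually
      (lt_mem_nhds (Squeezed.weight_point_pos y s))
    filter_upwards [hw] with i hi
    rcases hp i with h3 | h3 | h3
    · exact h3
    · simp [h3, Squeezed.weight] at hi
    · rw [mem_singleton_iff] at h3
      simp [h3, Squeezed.weight] at hi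
  have : Nonempty I := ⟨s⟩
  have : Nonempty X := ⟨y⟩
  obtain ⟨t, ht⟩ := hreal.choice
  obtain ⟨x, hx⟩ := ht.choice
  have h' := h.congr' (hx.mono fun i hi => hi.2)
  exact ⟨t, x, hx, Squeezed.time_of_tendsto_point h', Squeezed.space_of_tendsto_point h'⟩

/-- Only equal finite limit times need care. If the times before the limit differ, the right end `b`
of the earlier segment precedes the left end `c` of the later one in the limit, so `x' ≼ b ≼ c ≼
y'`. If they agree, betweenness on the common segment passes to the limit. -/
theorem SplitLimit.graphLE_of_tendsto (hB : B.IsCompatible)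
    {W : Ultrafilter ι} {g : ι → Cadlag I X} {f : Cadlag I X} (h : B.SplitLimit W g f)
    {p q : ι → Squeezed X} (hp : ∀ i, p i ∈ B.filledGraph (g i))
    (hq : ∀ i, q i ∈ B.filledGraph (g i)) (hpq : ∀ᶠ i in (W : Filter ι), B.graphLE (g i) (p i) (q i))
    {p' q' : Squeezed X} (hp' : p' ∈ B.filledGraph f) (hq' : q' ∈ B.filledGraph f)
    (hpp : Tendsto p W (𝓝 p')) (hqq : Tendsto q W (𝓝 q')) : B.graphLE f p' q' := by
  by_cases hEq : ∀ᶠ i in (W : Filter ι), p i = q i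
  · exact Or.inr (Or.inl (tendsto_nhds_unique (hpp.congr' hEq) hqq))
  have hle : p'.scaledTime ≤ q'.scaledTime := by
    refine le_of_tendsto_of_tendsto ((Squeezed.continuous_scaledTime.tendsto _).comp hpp)
      ((Squeezed.continuous_scaledTime.tendsto _).comp hqq) ?_
    filter_upwards [hpq] with i hi
    rcases hi with hi | hi | ⟨s, x, y, h1, h2, -⟩
    · exact ((Squeezed.time_lt_iff _ _).1 hi).le
    · simp [hi]
    · simp [h1, h2, Squeezed.scaledTime]
  rcases hle.lt_or_eq with hlt | heq
  · exact Or.inl ((Squeezed.time_lt_iff _ _).2 hlt)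
  have htime : p'.time = q'.time := by
    refine le_antisymm (not_lt.1 fun h => ?_) (not_lt.1 fun h => ?_)
    · exact absurd ((Squeezed.time_lt_iff _ _).1 h) heq.not_gt
    · exact absurd ((Squeezed.time_lt_iff _ _).1 h) heq.not_lt
  rcases hp' with ⟨s, x', hx', rfl⟩ | hp'
  swap
  · rcases hq' with ⟨s, y', hy', rfl⟩ | hq'
    · rcases hp' with rfl | rfl <;> simp [Squeezed.time] at htime
    · right; left
      rcases hp' with rfl | rfl <;> rcases hq' with rfl | rfl <;> first
        | rfl
        | simp [Squeezed.time] at htime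
  rcases hq' with ⟨s', y', hy', rfl⟩ | hq'
  swap
  · rcases hq' with rfl | rfl <;> simp [Squeezed.time] at htime
  simp only [Squeezed.time, EReal.coe_eq_coe_iff] at htime
  obtain rfl := Subtype.ext htime
  obtain ⟨t, x, htx, hts, hxx⟩ := exists_real_of_tendsto hp hpp
  obtain ⟨u, y, huy, hus, hyy⟩ := exists_real_of_tendsto hq hqq
  obtain ⟨a, b, x'', ha, hb, hxx', hab, hbs, hxab⟩ :=
    h.exists_tendsto_space hB (htx.mono fun i hi => hi.1) hts
  obtain rfl := tendsto_nhds_unique hxx hxx'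
  obtain ⟨c, d, y'', hc, hd, hyy', hcd, hds, hycd⟩ :=
    h.exists_tendsto_space hB (huy.mono fun i hi => hi.1) hus
  obtain rfl := tendsto_nhds_unique hyy hyy'
  rw [graphLE_point_iff]
  right
  have hcy : c ∈ B.seg (f.left s) y' := mem_seg_of_mem_seg_right hcd hycd
  have hcases : (∀ᶠ i in (W : Filter ι), (t i : ℝ) < u i) ∨
      ∀ᶠ i in (W : Filter ι), t i = u i ∧ x i ∈ B.seg ((g i).left (t i)) (y i) := by
    rw [← Ultrafilter.eventually_or]
    filter_upwards [hpq, htx, huy, Ultrafilter.eventually_not.2 hEq] with i h1 h2 h3 h4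
    rw [h2.2, h3.2] at h1 h4
    rcases h1 with h1 | h1 | ⟨r, v, w, h5, h6, h7⟩
    · left
      simpa [Squeezed.time] using h1
    · exact absurd h1 h4
    · right
      injection h5 with h5 h5'
      injection h6 with h6 h6'
      obtain rfl := Subtype.ext h5'
      rw [h5, h6]
      exact ⟨(Subtype.ext h6').symm, h7⟩
  rcases hcases with hlt | hsame
  · obtain ⟨b', c', hb', hc', hbc, -⟩ := h (fun i => toLex (t i, true))
      (fun i => toLex (u i, false)) s (hlt.mono fun i hi => le_of_splitReal_lt hi) hts hus
    obtain rfl := tendsto_nhds_unique hb hb'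
    obtain rfl := tendsto_nhds_unique hc hc'
    exact seg_trans (seg_trans (seg_subset_right hab hxab) hbc) hcy
  · have hac : a = c := by
      refine tendsto_nhds_unique ha (hc.congr' ?_)
      filter_upwards [hsame] with i hi
      rw [hi.1]
    subst hac
    have hxy : x' ∈ B.seg a y' := hB.mem_seg_of_tendsto hxx ha hyy (hsame.mono fun i hi => hi.2)
    exact seg_subset_right hcy hxy

theorem SplitLimit.exists_tendsto_orderedGraph (hI : IsClosed I) (hB : B.IsCompatible)
    {W : Ultrafilter ι} {g : ι → Cadlag I X} {f : Cadlag I X} (h : B.SplitLimit W g f)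
    {p : ι → Squeezed X × Squeezed X} (hp : ∀ i, p i ∈ B.orderedGraph (g i)) :
    ∃ q ∈ B.orderedGraph f, Tendsto p W (𝓝 q) := by
  obtain ⟨a, ha, hpa⟩ := h.exists_tendsto_filledGraph hI hB fun i => (hp i).1
  obtain ⟨b, hb, hpb⟩ := h.exists_tendsto_filledGraph hI hB fun i => (hp i).2.1
  refine ⟨(a, b), ⟨ha, hb, ?_⟩, hpa.prodMk_nhds hpb⟩
  exact h.graphLE_of_tendsto hB (fun i => (hp i).1) (fun i => (hp i).2.1)
    (Eventually.of_forall fun i => (hp i).2.2) ha hb hpa hpb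

theorem negInf_mem_orderedGraph (B : Betweenness X) (f : Cadlag I X) :
    (Squeezed.negInf, Squeezed.negInf) ∈ B.orderedGraph f :=
  ⟨B.negInf_mem_filledGraph f, B.negInf_mem_filledGraph f, Or.inr (Or.inl rfl)⟩

variable [I.OrdConnected]

/-- An ultrafilter on the graph is the family of its own points, indexed by themselves, over the
constant family of functions `f`. -/
theorem isCompact_filledGraph (hI : IsClosed I) (hB : B.IsCompatible) (f : Cadlag I X) :
    IsCompact (B.filledGraph f) := by
  rw [isCompact_iff_ultrafilter_le_nhds']
  intro W hW
  classical
  obtain ⟨q, hq, hpq⟩ := (B.splitLimit_const W f).exists_tendsto_filledGraph hI hB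
    -- The value `negInf` is a filler: membership is required at every index, but only indices in a
    -- set of `W` matter.
    (p := fun i => if i ∈ B.filledGraph f then i else .negInf) (fun i => by
      split_ifs with h
      · exact h
      · exact B.negInf_mem_filledGraph f)
  refine ⟨q, hq, ?_⟩
  have : Tendsto id W (𝓝 q) := hpq.congr' (by
    filter_upwards [hW] with i hi
    simp [hi])
  exact this

theorem isCompact_orderedGraph (hI : IsClosed I) (hB : B.IsCompatible) (f : Cadlag I X) :
    IsCompact (B.orderedGraph f) := by
  rw [isCompact_iff_ultrafilter_le_nhds']
  intro W hW
  classical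
  obtain ⟨q, hq, hpq⟩ := (B.splitLimit_const W f).exists_tendsto_orderedGraph hI hB
    (p := fun i => if i ∈ B.orderedGraph f then i else (.negInf, .negInf)) (fun i => by
      split_ifs with h
      · exact h
      · exact B.negInf_mem_orderedGraph f)
  refine ⟨q, hq, ?_⟩
  have : Tendsto id W (𝓝 q) := hpq.congr' (by
    filter_upwards [hW] with i hi
    simp [hi])
  exact this

end Betweenness

/-! ### Necessity of the three conditions. -/

theorem exists_ultrafilter_of_not_tendsto_zero {α : Type*} {l : Filter α} {u : α → ℝ≥0∞}
    (h : ¬ Tendsto u l (𝓝 0)) :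
    ∃ ε > 0, ∃ W : Ultrafilter α, (W : Filter α) ≤ l ∧ ∀ᶠ δ in (W : Filter α), ε < u δ := by
  rw [ENNReal.tendsto_nhds_zero] at h
  push Not at h
  obtain ⟨ε, hε, hf⟩ := h
  have hne : (l ⊓ 𝓟 {a | ε < u a}).NeBot := frequently_mem_iff_neBot.1 hf
  have hle := Ultrafilter.of_le (l ⊓ 𝓟 {a | ε < u a})
  exact ⟨ε, hε, Ultrafilter.of _, hle.trans inf_le_left, le_principal_iff.1 (hle.trans inf_le_right)⟩

theorem Ultrafilter.exists_tendsto_of_abs_le {ι : Type*} (W : Ultrafilter ι) {t : ι → ℝ} {T : ℝ}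
    (h : ∀ᶠ i in (W : Filter ι), |t i| ≤ T) : ∃ s, Tendsto t W (𝓝 s) := by
  obtain ⟨s, -, hs⟩ := isCompact_iff_ultrafilter_le_nhds'.1 (isCompact_Icc (a := -T) (b := T))
    (W.map t) (by
      change ∀ᶠ i in (W : Filter ι), t i ∈ Icc (-T) T
      filter_upwards [h] with i h1
      exact abs_le.1 h1)
  exact ⟨s, hs⟩

section Endpoints

variable {I : Set ℝ} {t : I}

theorem isMin_or_isMax_of_notMem_interior [I.OrdConnected] (h : (t : ℝ) ∉ interior I) :
    IsMin t ∨ IsMax t := by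
  by_contra hcon
  push Not at hcon
  obtain ⟨a, ha⟩ := not_isMin_iff.1 hcon.1
  obtain ⟨b, hb⟩ := not_isMax_iff.1 hcon.2
  exact h (mem_interior_iff_mem_nhds.2 (mem_of_superset (Icc_mem_nhds ha hb)
    (Set.OrdConnected.out ‹_› a.2 b.2)))

theorem notMem_interior_of_isMin (h : IsMin t) : (t : ℝ) ∉ interior I := by
  intro ht
  obtain ⟨l, hl, hlt⟩ := exists_Ioc_subset_of_mem_nhds (mem_interior_iff_mem_nhds.1 ht)
    ⟨(t : ℝ) - 1, by linarith⟩
  obtain ⟨r, hr1, hr2⟩ := exists_between hl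
  have : t ≤ (⟨r, hlt ⟨hr1, hr2.le⟩⟩ : I) := h hr2.le
  exact absurd hr2 (not_lt.2 this)

theorem notMem_interior_of_isMax (h : IsMax t) : (t : ℝ) ∉ interior I := by
  intro ht
  obtain ⟨l, hl, hlt⟩ := exists_Ico_subset_of_mem_nhds (mem_interior_iff_mem_nhds.1 ht)
    ⟨(t : ℝ) + 1, by linarith⟩
  obtain ⟨r, hr1, hr2⟩ := exists_between hl
  have : (⟨r, hlt ⟨hr1.le, hr2⟩⟩ : I) ≤ t := h hr1.le
  exact absurd hr1 (not_lt.2 this)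

theorem Cadlag.left_eq_of_notMem_interior {X : Type*} [MetricSpace X] [I.OrdConnected]
    (f : Cadlag I X) (h : (t : ℝ) ∉ interior I) : f.left t = f.toFun t := by
  rcases isMin_or_isMax_of_notMem_interior h with h | h
  · exact f.left_eq_of_isMin h
  · exact f.left_eq_of_isMax h

end Endpoints

namespace Betweenness

variable {I : Set ℝ} {X ι : Type*} [MetricSpace X] {B : Betweenness X}

theorem graphLE_split (B : Betweenness X) (f : Cadlag I X) {τ σ : I ×ₗ Bool} (h : τ ≤ σ) :
    B.graphLE f (.point (f.split τ) (splitReal τ)) (.point (f.split σ) (splitReal σ)) := by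
  rcases Prod.Lex.le_iff.1 h with h | ⟨h1, h2⟩
  · left
    simpa [Squeezed.time] using (show splitReal τ < splitReal σ from h)
  · have h3 : splitReal τ = splitReal σ := congrArg Subtype.val h1
    rw [h3]
    refine graphLE_point_iff (s := (ofLex σ).1).2 ?_
    unfold Cadlag.split
    cases hb : (ofLex τ).2
    · right
      simp only [Bool.false_eq_true, if_false, h1]
      exact B.left_mem _ _
    · rw [hb] at h2
      have : (ofLex σ).2 = true := Bool.eq_true_of_true_le h2
      left
      simp [this, h1]

variable [I.OrdConnected]

/-- A pair of ordered split values is a point of the ordered graph of `g i`, hence asymptotically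
close to the compact ordered graph of `f`. It therefore converges to a pair in that graph, and this
pair carries the required order. -/
theorem splitLimit_of_tendsto (hI : IsClosed I) (hB : B.IsCompatible) {W : Ultrafilter ι}
    {g : ι → Cadlag I X} {f : Cadlag I X}
    (h : Tendsto (fun i => Metric.hausdorffEDist (B.orderedGraph (g i)) (B.orderedGraph f)) W
      (𝓝 0)) : B.SplitLimit W g f := by
  intro τ σ s hτσ hτ hσ
  let p : ι → Squeezed X × Squeezed X := fun i =>
    (.point ((g i).split (τ i)) (splitReal (τ i)), .point ((g i).split (σ i)) (splitReal (σ i)))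
  have hp : ∀ᶠ i in (W : Filter ι), p i ∈ B.orderedGraph (g i) := by
    filter_upwards [hτσ] with i hi
    exact ⟨B.split_mem_filledGraph _ _, B.split_mem_filledGraph _ _, B.graphLE_split _ hi⟩
  obtain ⟨⟨q, r⟩, hqr, hpq⟩ := (B.isCompact_orderedGraph hI hB f).exists_tendsto_of_infEDist
    ⟨_, B.negInf_mem_orderedGraph f⟩ W (z := p)
    (tendsto_of_tendsto_of_tendsto_of_le_of_le' tendsto_const_nhds h
      (Eventually.of_forall fun _ => zero_le)
      (hp.mono fun i hi => Metric.infEDist_le_hausdorffEDist_of_mem hi))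
  have hbd : ∀ {u : ι → ℝ}, Tendsto u W (𝓝 (s : ℝ)) →
      ∀ᶠ i in (W : Filter ι), |u i| ≤ |(s : ℝ)| + 1 := fun hu =>
    (hu.abs.eventually (gt_mem_nhds (lt_add_one _))).mono fun _ => le_of_lt
  obtain ⟨x, s₁, rfl, hx, hs₁⟩ := Squeezed.exists_eq_point_of_tendsto (hbd hτ)
    ((continuous_fst.tendsto _).comp hpq)
  obtain ⟨y, s₂, rfl, hy, hs₂⟩ := Squeezed.exists_eq_point_of_tendsto (hbd hσ)
    ((continuous_snd.tendsto _).comp hpq)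
  obtain rfl := tendsto_nhds_unique hs₁ hτ
  obtain rfl := tendsto_nhds_unique hs₂ hσ
  refine ⟨x, y, hx, hy, ?_, point_mem_filledGraph_iff.1 hqr.2.1⟩
  rcases graphLE_point_iff.1 hqr.2.2 with h | h
  · rw [h]; exact B.right_mem _ _
  · exact h

theorem IsPrecompact.exists_splitLimit (hI : IsClosed I) (hB : B.IsCompatible)
    {F : Set (Cadlag I X)} (hF : B.IsPrecompact F) (W : Ultrafilter ι) {g : ι → Cadlag I X}
    (hg : ∀ᶠ i in (W : Filter ι), g i ∈ @closure _ (B.skorohodTopology I) F) :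
    ∃ f ∈ @closure _ (B.skorohodTopology I) F, B.SplitLimit W g f := by
  let _ := B.skorohodMetric I
  obtain ⟨f, hf, hle⟩ := isCompact_iff_ultrafilter_le_nhds'.1
    (show IsCompact (closure F) from hF) (W.map g) hg
  have hle' : Tendsto g W (𝓝 f) := hle
  rw [tendsto_iff_edist_tendsto_0] at hle'
  exact ⟨f, hf, splitLimit_of_tendsto hI hB hle'⟩

omit [I.OrdConnected] in
theorem subset_skorohod_closure (B : Betweenness X) (F : Set (Cadlag I X)) :
    F ⊆ @closure _ (B.skorohodTopology I) F :=
  @subset_closure _ (B.skorohodTopology I) F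

/-- The compact set collects the full segments of all functions in the closure of `F`. Taking the
closure matters, since the limit functions must contribute as well. -/
theorem IsPrecompact.compactContainment (hI : IsClosed I) (hB : B.IsCompatible)
    {F : Set (Cadlag I X)} (hF : B.IsPrecompact F) : CompactContainment F := by
  intro T
  refine ⟨{x | ∃ (f : Cadlag I X) (t : I), f ∈ @closure _ (B.skorohodTopology I) F ∧
    |(t : ℝ)| ≤ T ∧ x ∈ B.seg (f.left t) (f.toFun t)}, ?_, ?_⟩
  · rw [isCompact_iff_ultrafilter_le_nhds']
    intro W hW
    have hW' : ∀ᶠ x in (W : Filter X), ∃ (f : Cadlag I X) (t : I),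
        f ∈ @closure _ (B.skorohodTopology I) F ∧ |(t : ℝ)| ≤ T ∧
        x ∈ B.seg (f.left t) (f.toFun t) := hW
    obtain ⟨x₀, f₀, t₀, -⟩ := hW'.exists
    have : Nonempty (Cadlag I X) := ⟨f₀⟩
    have : Nonempty I := ⟨t₀⟩
    -- The points of `X` index themselves: a function and a time are chosen for each `x`.
    obtain ⟨g, hg⟩ := hW'.choice
    obtain ⟨t, ht⟩ := hg.choice
    obtain ⟨s, hs⟩ := W.exists_tendsto_of_abs_le (ht.mono fun x hx => hx.2.1)
    have hsI : s ∈ I := hI.mem_of_tendsto hs (Eventually.of_forall fun i => (t i).2)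
    obtain ⟨f, hf, hlim⟩ := hF.exists_splitLimit hI hB W (ht.mono fun x hx => hx.1)
    obtain ⟨a, b, y, -, -, hy, hab, hb, hyab⟩ := hlim.exists_tendsto_space hB (s := ⟨s, hsI⟩)
      (ht.mono fun x hx => hx.2.2) hs
    exact ⟨y, ⟨f, ⟨s, hsI⟩, hf,
      le_of_tendsto hs.abs (ht.mono fun x hx => hx.2.1),
      seg_subset_left hb (seg_subset_right hab hyab)⟩, hy⟩
  · intro f hf τ hτ
    exact ⟨f, (ofLex τ).1, B.subset_skorohod_closure F hf, hτ, B.split_mem_seg f τ⟩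

theorem IsPrecompact.tendsto_skorohodModulus (hI : IsClosed I) (hB : B.IsCompatible)
    {F : Set (Cadlag I X)} (hF : B.IsPrecompact F) (T : ℝ) :
    Tendsto (fun δ : ℝ => ⨆ f ∈ F, B.skorohodModulus T δ f) (𝓝[>] 0) (𝓝 0) := by
  by_contra hcon
  obtain ⟨ε, hε, W, hW, hbad⟩ := exists_ultrafilter_of_not_tendsto_zero hcon
  simp only [skorohodModulus, lt_iSup_iff] at hbad
  obtain ⟨-, f₀, -, τ₀, -⟩ := hbad.exists
  have : Nonempty (Cadlag I X) := ⟨f₀⟩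
  have : Nonempty (I ×ₗ Bool) := ⟨τ₀⟩
  obtain ⟨g, hg⟩ := hbad.choice
  simp only [exists_prop, ← exists_and_left] at hg
  obtain ⟨τ₁, h⟩ := hg.choice
  obtain ⟨τ₂, h⟩ := h.choice
  obtain ⟨τ₃, h⟩ := h.choice
  obtain ⟨f, -, hlim⟩ := hF.exists_splitLimit hI hB W
    (h.mono fun i hi => B.subset_skorohod_closure F hi.1)
  obtain ⟨s, hs⟩ := W.exists_tendsto_of_abs_le (t := fun i => splitReal (τ₁ i)) (T := T) (by
    filter_upwards [h] with i hi
    have h1 := splitReal_mono hi.2.1.1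
    have h2 := splitReal_mono hi.2.1.2.1
    obtain ⟨-, -, h3, h4, -⟩ := hi.2.1
    exact abs_le.2 ⟨h3, by linarith⟩)
  have hsI : s ∈ I := hI.mem_of_tendsto hs (Eventually.of_forall fun i => (ofLex (τ₁ i)).1.2)
  -- The index of the ultrafilter is `δ` itself, so the three times merge in the limit.
  have hW0 : Tendsto id (W : Filter ℝ) (𝓝 0) := hW.trans nhdsWithin_le_nhds
  have hs' := hs.add hW0
  rw [add_zero] at hs'
  have hs₃ : Tendsto (fun i => splitReal (τ₃ i)) W (𝓝 s) := by
    refine tendsto_of_tendsto_of_tendsto_of_le_of_le' hs hs' ?_ ?_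
    · filter_upwards [h] with i hi
      exact splitReal_mono (hi.2.1.1.trans hi.2.1.2.1)
    · filter_upwards [h] with i hi
      have := hi.2.1.2.2.2.2
      simp only [id]
      linarith
  have hs₂ : Tendsto (fun i => splitReal (τ₂ i)) W (𝓝 s) := by
    refine tendsto_of_tendsto_of_tendsto_of_le_of_le' hs hs₃ ?_ ?_
    · filter_upwards [h] with i hi using splitReal_mono hi.2.1.1
    · filter_upwards [h] with i hi using splitReal_mono hi.2.1.2.1
  obtain ⟨x₁, x₂, hx₁, hx₂, h12, -⟩ := hlim τ₁ τ₂ ⟨s, hsI⟩ (h.mono fun i hi => hi.2.1.1) hs hs₂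
  obtain ⟨x₂', x₃, hx₂', hx₃, h23, -⟩ := hlim τ₂ τ₃ ⟨s, hsI⟩ (h.mono fun i hi => hi.2.1.2.1) hs₂ hs₃
  obtain rfl := tendsto_nhds_unique hx₂ hx₂'
  -- The points `w i` of the outer segments approach the same limit as the middle values, which
  -- contradicts a distance above `ε`.
  obtain ⟨w, hw, hwx⟩ := hB.exists_mem_seg_tendsto hx₁ hx₃ (mem_seg_of_le_of_le h12 h23)
  have hd := hx₂.edist hwx
  rw [edist_self] at hd
  obtain ⟨i, hi, hi'⟩ := ((hd.eventually (gt_mem_nhds hε)).and h).exists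
  exact absurd (hi'.2.2.trans_le (Metric.infEDist_le_edist_of_mem (hw i))) hi.not_gt

theorem IsPrecompact.tendsto_endpoint (hI : IsClosed I) (hB : B.IsCompatible)
    {F : Set (Cadlag I X)} (hF : B.IsPrecompact F) {t : I} (ht : (t : ℝ) ∉ interior I) :
    Tendsto (fun δ : ℝ => ⨆ f ∈ F, ⨆ (s : I) (_ : |(s : ℝ) - (t : ℝ)| ≤ δ),
      edist (f.toFun s) (f.toFun t)) (𝓝[>] 0) (𝓝 0) := by
  by_contra hcon
  obtain ⟨ε, hε, W, hW, hbad⟩ := exists_ultrafilter_of_not_tendsto_zero hcon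
  simp only [lt_iSup_iff] at hbad
  obtain ⟨-, f₀, -⟩ := hbad.exists
  have : Nonempty (Cadlag I X) := ⟨f₀⟩
  have : Nonempty I := ⟨t⟩
  obtain ⟨g, hg⟩ := hbad.choice
  simp only [exists_prop, ← exists_and_left] at hg
  obtain ⟨s, h⟩ := hg.choice
  obtain ⟨f, -, hlim⟩ := hF.exists_splitLimit hI hB W
    (h.mono fun i hi => B.subset_skorohod_closure F hi.1)
  have hW0 : Tendsto id (W : Filter ℝ) (𝓝 0) := hW.trans nhdsWithin_le_nhds
  have hs : Tendsto (fun i => (s i : ℝ)) W (𝓝 (t : ℝ)) := by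
    rw [tendsto_iff_dist_tendsto_zero]
    refine squeeze_zero' (Eventually.of_forall fun _ => dist_nonneg) ?_ hW0
    filter_upwards [h] with i hi using hi.2.1
  have hval : ∀ r : ℝ → I, Tendsto (fun i => (r i : ℝ)) W (𝓝 (t : ℝ)) →
      Tendsto (fun i => (g i).toFun (r i)) W (𝓝 (f.toFun t)) := by
    intro r hr
    obtain ⟨x, y, hx, hy, -, hyt⟩ := hlim (fun i => toLex (r i, true)) (fun i => toLex (r i, true))
      t (Eventually.of_forall fun _ => le_rfl) hr hr
    -- There is no jump at an endpoint, so the segment at `t` is one point and every limit value is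
    -- `f(t)`.
    rw [f.left_eq_of_notMem_interior ht, seg_self] at hyt
    rw [mem_singleton_iff] at hyt
    rw [← hyt]
    exact hy
  have hd := (hval s hs).edist (hval (fun _ => t) tendsto_const_nhds)
  rw [edist_self] at hd
  obtain ⟨i, hi, hi'⟩ := ((hd.eventually (gt_mem_nhds hε)).and h).exists
  exact absurd hi'.2.2 hi.not_gt

end Betweenness

/-! ### Sufficiency: crossing times and the cadlag limit. -/

theorem Filter.curry_neBot {α β : Type*} (l : Filter α) (m : Filter β) [l.NeBot] [m.NeBot] :
    (l.curry m).NeBot := by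
  rw [neBot_iff, Ne, ← eventually_false_iff_eq_bot, eventually_curry_iff]
  simp [‹l.NeBot›.ne, ‹m.NeBot›.ne]

/-- A substitute for the intermediate value theorem: `r` is the last time at which `ψ ∘ f` is
nonpositive, taken as a supremum. No signs are assumed at `u` and `v`, hence the alternatives `r =
u` and `r = v`. -/
theorem Cadlag.exists_crossing {I : Set ℝ} [I.OrdConnected] {X : Type*} [MetricSpace X]
    (f : Cadlag I X) {ψ : X → ℝ} (hψ : Continuous ψ) {u v : I} (huv : u ≤ v) :
    ∃ r : I, u ≤ r ∧ r ≤ v ∧ (r = v ∨ 0 ≤ ψ (f.toFun r)) ∧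
      (r = u ∨ ψ (f.left r) ≤ 0 ∨ ψ (f.toFun r) ≤ 0) := by
  let S : Set I := {t | u ≤ t ∧ t ≤ v ∧ (t = u ∨ ψ (f.toFun t) ≤ 0)}
  have huS : u ∈ S := ⟨le_rfl, huv, Or.inl rfl⟩
  obtain ⟨r, hr⟩ : ∃ r : I, IsLUB S r := by
    have hbdd : BddAbove (Subtype.val '' S : Set ℝ) :=
      ⟨v, by rintro _ ⟨t, ht, rfl⟩; exact ht.2.1⟩
    have hlub := isLUB_csSup ⟨_, mem_image_of_mem _ huS⟩ hbdd
    have hle : sSup (Subtype.val '' S : Set ℝ) ≤ v :=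
      hlub.2 (by rintro _ ⟨t, ht, rfl⟩; exact ht.2.1)
    refine ⟨⟨_, Set.OrdConnected.out ‹_› u.2 v.2 ⟨hlub.1 (mem_image_of_mem _ huS), hle⟩⟩, ?_, ?_⟩
    · intro t ht
      exact hlub.1 (mem_image_of_mem _ ht)
    · intro t ht
      exact hlub.2 (by rintro _ ⟨w, hw, rfl⟩; exact ht hw)
  have hur : u ≤ r := hr.1 huS
  have hrv : r ≤ v := hr.2 fun t ht => ht.2.1
  refine ⟨r, hur, hrv, ?_, ?_⟩
  · rcases hrv.lt_or_eq with hlt | heq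
    · right
      have : (𝓝[>] r).NeBot := nhdsGT_neBot_of_exists_gt ⟨v, hlt⟩
      refine ge_of_tendsto ((hψ.tendsto _).comp (f.right_continuous r)) ?_
      filter_upwards [self_mem_nhdsWithin, mem_nhdsWithin_of_mem_nhds (Iio_mem_nhds hlt)]
        with t h1 h2
      by_contra h3
      exact absurd (hr.1 (show t ∈ S from ⟨hur.trans (le_of_lt h1), le_of_lt h2,
        Or.inr (not_le.1 h3).le⟩)) (not_le.2 h1)
    · exact Or.inl heq
  · by_contra hcon
    push Not at hcon
    obtain ⟨h1, h2, h3⟩ := hcon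
    have hur' : u < r := lt_of_le_of_ne hur (Ne.symm h1)
    have h4 : ∀ᶠ t in 𝓝[<] r, 0 < ψ (f.toFun t) :=
      ((hψ.tendsto _).comp (f.tendsto_left r)).eventually (lt_mem_nhds h2)
    rw [eventually_nhdsWithin_iff] at h4
    -- The supremum is a limit of points of `S` from the left or lies in `S`; positivity just before
    -- `r` and at `r` excludes both.
    refine hr.frequently_mem ⟨u, huS⟩ ?_
    rw [eventually_nhdsWithin_iff]
    filter_upwards [h4, Ioi_mem_nhds hur'] with t h5 h6 h7 h8
    rcases lt_or_eq_of_le (show t ≤ r from h7) with h9 | rfl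
    · rcases h8.2.2 with h10 | h10
      · exact absurd h10 (ne_of_gt h6)
      · exact absurd (h5 h9) (not_lt.2 h10)
    · rcases h8.2.2 with h10 | h10
      · exact h1 h10
      · exact absurd h3 (not_lt.2 h10)

namespace Betweenness

variable {I : Set ℝ} {X ι κ : Type*} [MetricSpace X] {B : Betweenness X} {F : Set (Cadlag I X)}

/-- A uniform bound on the Skorohod modulus forces betweenness of limits of values at ordered
split times that converge to a common time. -/
theorem mem_seg_of_tendsto_skorohodModulus (hB : B.IsCompatible)
    (hmod : ∀ T : ℝ, 0 < T →
      Tendsto (fun δ : ℝ => ⨆ f ∈ F, B.skorohodModulus T δ f) (𝓝[>] 0) (𝓝 0))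
    {W : Filter ι} [W.NeBot] {g : ι → Cadlag I X} (hg : ∀ᶠ i in W, g i ∈ F)
    {τ₁ τ₂ τ₃ : ι → I ×ₗ Bool} {s : ℝ} (h12 : ∀ᶠ i in W, τ₁ i ≤ τ₂ i)
    (h23 : ∀ᶠ i in W, τ₂ i ≤ τ₃ i) (hs₁ : Tendsto (fun i => splitReal (τ₁ i)) W (𝓝 s))
    (hs₃ : Tendsto (fun i => splitReal (τ₃ i)) W (𝓝 s)) {x₁ x₂ x₃ : X}
    (hx₁ : Tendsto (fun i => (g i).split (τ₁ i)) W (𝓝 x₁))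
    (hx₂ : Tendsto (fun i => (g i).split (τ₂ i)) W (𝓝 x₂))
    (hx₃ : Tendsto (fun i => (g i).split (τ₃ i)) W (𝓝 x₃)) : x₂ ∈ B.seg x₁ x₃ := by
  refine hB.mem_seg_of_infEDist_le hx₂ hx₁ hx₃ fun ε hε => ?_
  obtain ⟨δ, hδ, hδ0⟩ := ((ENNReal.tendsto_nhds_zero.1 (hmod (|s| + 1) (by positivity)) ε hε).and
    self_mem_nhdsWithin).exists
  have hd := hs₃.sub hs₁
  rw [sub_self] at hd
  filter_upwards [hg, h12, h23, hs₁.eventually (lt_mem_nhds (show -(|s| + 1) < s by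
    linarith [neg_abs_le s])), hs₃.eventually (gt_mem_nhds (show s < |s| + 1 by
    linarith [le_abs_self s])), hd.eventually (gt_mem_nhds hδ0)] with i h1 h2 h3 h4 h5 h6
  refine le_trans ?_ ((le_iSup₂ (f := fun f (_ : f ∈ F) => B.skorohodModulus (|s| + 1) δ f)
    (g i) h1).trans hδ)
  exact le_iSup_of_le (τ₁ i) (le_iSup_of_le (τ₂ i) (le_iSup_of_le (τ₃ i)
    (le_iSup_of_le ⟨h2, h3, h4.le, h5.le, h6.le⟩ le_rfl)))

/-- Condition 3 bounds the values near `t` uniformly over `F`, and the closed bound is inherited by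
left limits. -/
theorem tendsto_split_of_endpoint [I.OrdConnected] {t : I}
    (hend : Tendsto (fun δ : ℝ => ⨆ f ∈ F, ⨆ (s : I) (_ : |(s : ℝ) - (t : ℝ)| ≤ δ),
      edist (f.toFun s) (f.toFun t)) (𝓝[>] 0) (𝓝 0))
    {W : Filter ι} {g : ι → Cadlag I X} (hg : ∀ᶠ i in W, g i ∈ F) {x : X}
    (hx : Tendsto (fun i => (g i).toFun t) W (𝓝 x)) {τ : ι → I ×ₗ Bool}
    (hτ : Tendsto (fun i => splitReal (τ i)) W (𝓝 (t : ℝ))) :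
    Tendsto (fun i => (g i).split (τ i)) W (𝓝 x) := by
  have hzero : Tendsto (fun i => edist ((g i).split (τ i)) ((g i).toFun t)) W (𝓝 0) := by
    rw [ENNReal.tendsto_nhds_zero]
    intro ε hε
    obtain ⟨δ, hδ, hδ0⟩ := ((ENNReal.tendsto_nhds_zero.1 hend ε hε).and
      self_mem_nhdsWithin).exists
    have hd := (hτ.sub_const (t : ℝ)).abs
    rw [sub_self, abs_zero] at hd
    filter_upwards [hg, hd.eventually (gt_mem_nhds hδ0)] with i h1 h2
    have hbound : ∀ r : I, |(r : ℝ) - (t : ℝ)| ≤ δ →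
        edist ((g i).toFun r) ((g i).toFun t) ≤ ε := fun r hr => by
      refine le_trans ?_ ((le_iSup₂ (f := fun (f : Cadlag I X) (_ : f ∈ F) =>
        ⨆ (s : I) (_ : |(s : ℝ) - (t : ℝ)| ≤ δ), edist (f.toFun s) (f.toFun t)) (g i) h1).trans hδ)
      exact le_iSup₂ (f := fun (s : I) (_ : |(s : ℝ) - (t : ℝ)| ≤ δ) =>
        edist ((g i).toFun s) ((g i).toFun t)) r hr
    unfold Cadlag.split
    split_ifs
    · exact hbound _ h2.le
    · refine (g i).left_mem_of_isClosed (S := {z | edist z ((g i).toFun t) ≤ ε})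
        (isClosed_le (by fun_prop) continuous_const) ?_
      refine eventually_nhdsWithin_of_eventually_nhds ?_
      have hc : Continuous fun r : I => |(r : ℝ) - (t : ℝ)| := by fun_prop
      filter_upwards [(hc.tendsto (ofLex (τ i)).1).eventually (gt_mem_nhds h2)] with r hr
      exact hbound r (le_of_lt hr)
  rw [tendsto_iff_edist_tendsto_0] at hx ⊢
  have hsum := hzero.add hx
  rw [add_zero] at hsum
  exact tendsto_of_tendsto_of_tendsto_of_le_of_le tendsto_const_nhds hsum (fun _ => zero_le)
    fun i => edist_triangle _ _ _

theorem _root_.CompactContainment.exists_tendsto_split (hcc : CompactContainment F)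
    {W : Ultrafilter ι} {g : ι → Cadlag I X} (hg : ∀ᶠ i in (W : Filter ι), g i ∈ F)
    {τ : ι → I ×ₗ Bool} {s : ℝ} (hτ : Tendsto (fun i => splitReal (τ i)) W (𝓝 s)) :
    ∃ x, Tendsto (fun i => (g i).split (τ i)) W (𝓝 x) := by
  obtain ⟨C, hC, hCF⟩ := hcc (|s| + 1)
  obtain ⟨x, -, hx⟩ := isCompact_iff_ultrafilter_le_nhds'.1 hC
    (W.map fun i => (g i).split (τ i)) (by
      change ∀ᶠ i in (W : Filter ι), (g i).split (τ i) ∈ C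
      filter_upwards [hg, hτ.abs.eventually (gt_mem_nhds (lt_add_one _))] with i h1 h2
      exact hCF _ h1 _ h2.le)
  exact ⟨x, hx⟩

section PointwiseLimit

variable {U : Ultrafilter κ} {g : κ → Cadlag I X} {H : I → X}

/-- Pointwise limits have limits along filters at `s` that are ordered from one side. -/
theorem exists_tendsto_pointwise_limit (hB : B.IsCompatible) (hcc : CompactContainment F)
    (hmod : ∀ T : ℝ, 0 < T →
      Tendsto (fun δ : ℝ => ⨆ f ∈ F, B.skorohodModulus T δ f) (𝓝[>] 0) (𝓝 0))
    (hg : ∀ᶠ k in (U : Filter κ), g k ∈ F)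
    (hH : ∀ t, Tendsto (fun k => (g k).toFun t) U (𝓝 (H t))) {s : I} {l : Filter I}
    (hl : l ≤ 𝓝 s)
    (hord : (∀ᶠ a in l, ∀ᶠ b in l, a ≤ b) ∨ ∀ᶠ a in l, ∀ᶠ b in l, b ≤ a) :
    ∃ x, Tendsto H l (𝓝 x) := by
  rcases eq_or_neBot l with rfl | hne
  · exact ⟨H s, tendsto_bot⟩
  obtain ⟨C, hC, hCF⟩ := hcc (|(s : ℝ)| + 1)
  have hHC : ∀ᶠ a in l, H a ∈ C := by
    have hc : Continuous fun r : I => |(r : ℝ)| := by fun_prop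
    filter_upwards [hl ((hc.tendsto s).eventually (gt_mem_nhds (lt_add_one _)))] with a ha
    refine hC.isClosed.mem_of_tendsto (hH a) ?_
    filter_upwards [hg] with k hk using hCF _ hk (toLex (a, true)) (le_of_lt ha)
  -- In a compact set it suffices that the cluster value is unique. Two cluster values `x` and `y`
  -- are compared through `x`, `y`, `x` at three successive times.
  obtain ⟨x, -, hx⟩ := hC.exists_mapClusterPt_of_frequently hHC.frequently
  refine ⟨x, hC.tendsto_nhds_of_unique_mapClusterPt hHC fun y _ hy => ?_⟩
  obtain ⟨V, hVl, hV⟩ := mapClusterPt_iff_ultrafilter.1 hx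
  obtain ⟨V', hVl', hV'⟩ := mapClusterPt_iff_ultrafilter.1 hy
  -- The index is `(a, b, c, k)`: `a` and `c` run along `V`, where `H → x`, and `b` along `V'`,
  -- where `H → y`. Each variable is chosen after the preceding ones, so `b` lies between `a` and
  -- `c` in time, and `k` comes last to bring `g k` close to `H`.
  have n1 := curry_neBot (V : Filter I) (U : Filter κ)
  have n2 := curry_neBot (V' : Filter I) ((V : Filter I).curry (U : Filter κ))
  have n3 := curry_neBot (V : Filter I) ((V' : Filter I).curry ((V : Filter I).curry (U : Filter κ)))
  have t1 := tendsto_snd_curry (V : Filter I) ((V' : Filter I).curry ((V : Filter I).curry (U : Filter κ)))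
  have t2 := (tendsto_snd_curry (V' : Filter I) ((V : Filter I).curry (U : Filter κ))).comp t1
  have t3 := (tendsto_snd_curry (V : Filter I) (U : Filter κ)).comp t2
  have hg' := t3.eventually hg
  have c1 : Tendsto (fun p : I × κ => (g p.2).toFun p.1) ((V : Filter I).curry (U : Filter κ)) (𝓝 x) :=
    Tendsto.curry_nhds (g := fun a k => (g k).toFun a) hH hV
  have x3 := c1.comp t2
  have c2 : Tendsto (fun p : I × (I × κ) => (g p.2.2).toFun p.1)
      ((V' : Filter I).curry ((V : Filter I).curry (U : Filter κ))) (𝓝 y) :=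
    Tendsto.curry_nhds (g := fun a (q : I × κ) => (g q.2).toFun a)
      (fun a => (hH a).comp (tendsto_snd_curry _ _)) hV'
  have x2 := c2.comp t1
  have x1 : Tendsto (fun p : I × (I × (I × κ)) => (g p.2.2.2).toFun p.1)
      ((V : Filter I).curry ((V' : Filter I).curry ((V : Filter I).curry (U : Filter κ)))) (𝓝 x) :=
    Tendsto.curry_nhds (g := fun a (q : I × (I × κ)) => (g q.2.2).toFun a)
      (fun a => (hH a).comp ((tendsto_snd_curry _ _).comp (tendsto_snd_curry _ _))) hV
  have hcoe : Tendsto (fun r : I => (r : ℝ)) l (𝓝 (s : ℝ)) :=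
    (continuous_subtype_val.tendsto s).mono_left hl
  have s1 := (hcoe.mono_left hVl).comp (tendsto_fst_curry (V : Filter I)
    ((V' : Filter I).curry ((V : Filter I).curry (U : Filter κ))))
  have s3 := ((hcoe.mono_left hVl).comp (tendsto_fst_curry (V : Filter I) (U : Filter κ))).comp t2
  have hlift : ∀ r : I → I → Prop, (∀ᶠ a in l, ∀ᶠ b in l, r a b) →
      (∀ᶠ p in (V : Filter I).curry ((V' : Filter I).curry ((V : Filter I).curry (U : Filter κ))),
        r p.1 p.2.1) ∧
      ∀ᶠ p in (V : Filter I).curry ((V' : Filter I).curry ((V : Filter I).curry (U : Filter κ))),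
        r p.2.1 p.2.2.1 := by
    intro r hr
    constructor
    · rw [eventually_curry_iff]
      filter_upwards [hVl hr] with a ha
      exact (tendsto_fst_curry _ _).eventually (hVl' ha)
    · refine t1.eventually (p := fun q : I × (I × κ) => r q.1 q.2.1) ?_
      rw [eventually_curry_iff]
      filter_upwards [hVl' hr] with a ha
      exact (tendsto_fst_curry _ _).eventually (hVl ha)
  have hmono : ∀ {a b : I}, a ≤ b → (toLex (a, true) : I ×ₗ Bool) ≤ toLex (b, true) := by
    intro a b hab
    rcases hab.lt_or_eq with h | rfl
    · exact le_of_splitReal_lt h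
    · exact le_rfl
  have hyx : y ∈ B.seg x x := by
    rcases hord with hord | hord
    · exact mem_seg_of_tendsto_skorohodModulus hB hmod hg'
        (τ₁ := fun p => toLex (p.1, true)) (τ₂ := fun p => toLex (p.2.1, true))
        (τ₃ := fun p => toLex (p.2.2.1, true)) ((hlift _ hord).1.mono fun _ => hmono)
        ((hlift _ hord).2.mono fun _ => hmono) s1 s3 x1 x2 x3
    · exact mem_seg_of_tendsto_skorohodModulus hB hmod hg'
        (τ₃ := fun p => toLex (p.1, true)) (τ₂ := fun p => toLex (p.2.1, true))
        (τ₁ := fun p => toLex (p.2.2.1, true)) ((hlift (fun a b => b ≤ a) hord).2.mono fun _ => hmono)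
        ((hlift (fun a b => b ≤ a) hord).1.mono fun _ => hmono) s3 s1 x3 x2 x1
  rw [seg_self] at hyx
  exact hyx

variable [I.OrdConnected]

theorem eq_of_tendsto_pointwise_limit_endpoint {t : I}
    (hend : Tendsto (fun δ : ℝ => ⨆ f ∈ F, ⨆ (s : I) (_ : |(s : ℝ) - (t : ℝ)| ≤ δ),
      edist (f.toFun s) (f.toFun t)) (𝓝[>] 0) (𝓝 0))
    (hg : ∀ᶠ k in (U : Filter κ), g k ∈ F)
    (hH : ∀ t, Tendsto (fun k => (g k).toFun t) U (𝓝 (H t))) {l : Filter I} [l.NeBot]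
    (hl : l ≤ 𝓝 t) {x : X} (hx : Tendsto H l (𝓝 x)) : x = H t := by
  have n1 := curry_neBot l (U : Filter κ)
  have h1 : Tendsto (fun p : I × κ => (g p.2).toFun p.1) (l.curry U) (𝓝 x) :=
    Tendsto.curry_nhds (g := fun a k => (g k).toFun a) hH hx
  have t1 := tendsto_snd_curry l (U : Filter κ)
  refine tendsto_nhds_unique h1 (tendsto_split_of_endpoint hend
    (g := fun p : I × κ => g p.2) (t1.eventually hg) ((hH t).comp t1)
    (τ := fun p : I × κ => toLex (p.1, true)) ?_)
  exact ((continuous_subtype_val.tendsto t).mono_left hl).comp (tendsto_fst_curry l (U : Filter κ))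

/-- The cadlag regularization of a pointwise limit. -/
theorem exists_cadlag_of_pointwise_limit (hB : B.IsCompatible) (hcc : CompactContainment F)
    (hmod : ∀ T : ℝ, 0 < T →
      Tendsto (fun δ : ℝ => ⨆ f ∈ F, B.skorohodModulus T δ f) (𝓝[>] 0) (𝓝 0))
    (hend : ∀ t : I, (t : ℝ) ∉ interior I →
      Tendsto (fun δ : ℝ => ⨆ f ∈ F, ⨆ (s : I) (_ : |(s : ℝ) - (t : ℝ)| ≤ δ),
        edist (f.toFun s) (f.toFun t)) (𝓝[>] 0) (𝓝 0))
    (hg : ∀ᶠ k in (U : Filter κ), g k ∈ F)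
    (hH : ∀ t, Tendsto (fun k => (g k).toFun t) U (𝓝 (H t))) :
    ∃ f : Cadlag I X, (∀ s, Tendsto H (𝓝[<] s) (𝓝 (f.left s))) ∧
      (∀ s, Tendsto H (𝓝[>] s) (𝓝 (f.toFun s))) ∧
      ∀ s : I, (s : ℝ) ∉ interior I → f.toFun s = H s := by
  have hleft : ∀ s : I, Tendsto H (𝓝[<] s) (𝓝 (Function.leftLim H s)) := fun s =>
    tendsto_leftLim_of_tendsto (exists_tendsto_pointwise_limit hB hcc hmod hg hH
      nhdsWithin_le_nhds (Or.inl (by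
        filter_upwards [self_mem_nhdsWithin] with a ha
        filter_upwards [mem_nhdsWithin_of_mem_nhds (Ioi_mem_nhds (show a < s from ha))] with b hb
        exact le_of_lt hb)))
  have hright : ∀ s : I, Tendsto H (𝓝[>] s) (𝓝 (Function.rightLim H s)) := fun s =>
    tendsto_rightLim_of_tendsto (exists_tendsto_pointwise_limit hB hcc hmod hg hH
      nhdsWithin_le_nhds (Or.inr (by
        filter_upwards [self_mem_nhdsWithin] with a ha
        filter_upwards [mem_nhdsWithin_of_mem_nhds (Iio_mem_nhds (show s < a from ha))] with b hb
        exact le_of_lt hb)))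
  -- Passing to right limits leaves the left limits of `H` unchanged; this makes the regularization
  -- cadlag and identifies its left limits.
  have hrl : ∀ s : I, Tendsto (Function.rightLim H) (𝓝[<] s) (𝓝 (Function.leftLim H s)) := by
    intro s
    refine (closed_nhds_basis _).tendsto_right_iff.2 ?_
    rintro S ⟨hSs, hS⟩
    filter_upwards [eventually_eventually_nhdsWithin.2 (hleft s hSs), self_mem_nhdsWithin]
      with c hc hcs
    rw [(isOpen_Iio : IsOpen (Iio s)).nhdsWithin_eq hcs] at hc
    rcases eq_or_neBot (𝓝[>] c) with h | h
    · rw [rightLim_eq_of_eq_bot _ h]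
      exact hc.self_of_nhds
    · exact hS.mem_of_tendsto (hright c) (nhdsWithin_le_nhds hc)
  -- Condition 3 is needed where `s` has times of `I` to its right; where it has none, `rightLim`
  -- defaults to the value of `H`.
  have hrend : ∀ s : I, (s : ℝ) ∉ interior I → Function.rightLim H s = H s := by
    intro s hs
    rcases eq_or_neBot (𝓝[>] s) with h | h
    · exact rightLim_eq_of_eq_bot _ h
    · exact eq_of_tendsto_pointwise_limit_endpoint (hend s hs) hg hH nhdsWithin_le_nhds (hright s)
  let f : Cadlag I X :=
    { toFun := Function.rightLim H
      right_continuous := fun t =>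
        (continuousWithinAt_rightLim_Ici (hright t)).mono_left
          (nhdsWithin_mono _ Ioi_subset_Ici_self)
      left_limit := fun t => ⟨_, hrl t⟩
      left_limit_max := fun t ht => by
        rcases eq_or_neBot (𝓝[<] t) with h | h
        · rw [h]; exact tendsto_bot
        · have hint := notMem_interior_of_isMax ht
          rw [hrend t hint]
          rw [← eq_of_tendsto_pointwise_limit_endpoint (hend t hint) hg hH nhdsWithin_le_nhds
            (hleft t)]
          exact hrl t }
  refine ⟨f, fun s => ?_, hright, hrend⟩
  rcases eq_or_neBot (𝓝[<] s) with h | h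
  · rw [h]; exact tendsto_bot
  · have : f.left s = Function.leftLim H s := tendsto_nhds_unique (f.tendsto_left s) (hrl s)
    rw [this]
    exact hleft s

end PointwiseLimit

end Betweenness

/-! ### Sufficiency: convergence of the ordered graphs. -/

theorem mem_of_infDist_le {X : Type*} [MetricSpace X] {A A' : Set X} {x : X} (hA : IsClosed A) (hne : A.Nonempty)
    (hx : x ∈ A') (h : Metric.infDist x A ≤ Metric.infDist x A') : x ∈ A := by
  rw [hA.mem_iff_infDist_zero hne]
  rw [Metric.infDist_zero_of_mem hx] at h
  exact le_antisymm h Metric.infDist_nonneg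

namespace Betweenness

variable {I : Set ℝ} {X ι κ : Type*} [MetricSpace X] {B : Betweenness X} {F : Set (Cadlag I X)}
  [I.OrdConnected]

/-- At interior times the modulus is applied to times `a < s < b` merging at `s`, where `H` tends to
`f(s-)` and `f(s+)`. The triple `a, τ, σ` puts `x` between `f(s-)` and `y`, and `a, σ, b` puts `y`
between `f(s-)` and `f(s+)`. Condition 3 settles the endpoints. -/
theorem splitLimit_of_pointwise_limit (hB : B.IsCompatible) (hcc : CompactContainment F)
    (hmod : ∀ T : ℝ, 0 < T →
      Tendsto (fun δ : ℝ => ⨆ f ∈ F, B.skorohodModulus T δ f) (𝓝[>] 0) (𝓝 0))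
    (hend : ∀ t : I, (t : ℝ) ∉ interior I →
      Tendsto (fun δ : ℝ => ⨆ f ∈ F, ⨆ (s : I) (_ : |(s : ℝ) - (t : ℝ)| ≤ δ),
        edist (f.toFun s) (f.toFun t)) (𝓝[>] 0) (𝓝 0))
    {W : Ultrafilter ι} {g : ι → Cadlag I X} {H : I → X} {f : Cadlag I X}
    (hg : ∀ᶠ i in (W : Filter ι), g i ∈ F)
    (hH : ∀ t, Tendsto (fun i => (g i).toFun t) W (𝓝 (H t)))
    (hleft : ∀ s, Tendsto H (𝓝[<] s) (𝓝 (f.left s)))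
    (hright : ∀ s, Tendsto H (𝓝[>] s) (𝓝 (f.toFun s)))
    (hfend : ∀ s : I, (s : ℝ) ∉ interior I → f.toFun s = H s) : B.SplitLimit W g f := by
  intro τ σ s hτσ hτ hσ
  obtain ⟨x, hx⟩ := hcc.exists_tendsto_split hg hτ
  obtain ⟨y, hy⟩ := hcc.exists_tendsto_split hg hσ
  refine ⟨x, y, hx, hy, ?_⟩
  by_cases hs : (s : ℝ) ∈ interior I
  · have hmin : ¬ IsMin s := fun h => notMem_interior_of_isMin h hs
    have hmax : ¬ IsMax s := fun h => notMem_interior_of_isMax h hs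
    have nl : (𝓝[<] s).NeBot := nhdsLT_neBot_of_exists_lt (not_isMin_iff.1 hmin)
    have nr : (𝓝[>] s).NeBot := nhdsGT_neBot_of_exists_gt (not_isMax_iff.1 hmax)
    have hcoe : ∀ A : Set I, Tendsto (fun r : I => (r : ℝ)) (𝓝[A] s) (𝓝 (s : ℝ)) := fun A =>
      (continuous_subtype_val.tendsto s).mono_left nhdsWithin_le_nhds
    constructor
    · have n1 := curry_neBot (𝓝[<] s) (W : Filter ι)
      have t1 := tendsto_snd_curry (𝓝[<] s) (W : Filter ι)
      refine mem_seg_of_tendsto_skorohodModulus hB hmod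
        (W := (𝓝[<] s).curry (W : Filter ι)) (g := fun p : I × ι => g p.2) (t1.eventually hg)
        (τ₁ := fun p : I × ι => toLex (p.1, true)) (τ₂ := fun p : I × ι => τ p.2)
        (τ₃ := fun p : I × ι => σ p.2) ?_ (t1.eventually hτσ)
        ((hcoe _).comp (tendsto_fst_curry _ _)) (hσ.comp t1) ?_ (hx.comp t1) (hy.comp t1)
      · rw [eventually_curry_iff]
        filter_upwards [self_mem_nhdsWithin] with a ha
        filter_upwards [hτ.eventually (lt_mem_nhds (show (a : ℝ) < s from ha))] with i hi
        exact le_of_splitReal_lt hi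
      · exact Tendsto.curry_nhds (g := fun a i => (g i).toFun a) hH (hleft s)
    · have n1 := curry_neBot (𝓝[>] s) (W : Filter ι)
      have n2 := curry_neBot (𝓝[<] s) ((𝓝[>] s).curry (W : Filter ι))
      have t1 := tendsto_snd_curry (𝓝[<] s) ((𝓝[>] s).curry (W : Filter ι))
      have t2 := tendsto_snd_curry (𝓝[>] s) (W : Filter ι)
      have t3 := t2.comp t1
      refine mem_seg_of_tendsto_skorohodModulus hB hmod
        (W := (𝓝[<] s).curry ((𝓝[>] s).curry (W : Filter ι)))
        (g := fun p : I × (I × ι) => g p.2.2) (t3.eventually hg)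
        (τ₁ := fun p => toLex (p.1, true)) (τ₂ := fun p => σ p.2.2)
        (τ₃ := fun p => toLex (p.2.1, true)) ?_ ?_ ((hcoe _).comp (tendsto_fst_curry _ _))
        (((hcoe (Ioi s)).comp (tendsto_fst_curry (𝓝[>] s) (W : Filter ι))).comp t1) ?_ (hy.comp t3) ?_
      · rw [eventually_curry_iff]
        filter_upwards [self_mem_nhdsWithin] with a ha
        filter_upwards [t2.eventually (hσ.eventually (lt_mem_nhds (show (a : ℝ) < s from ha)))]
          with i hi
        exact le_of_splitReal_lt hi
      · refine t1.eventually (p := fun q : I × ι => σ q.2 ≤ toLex (q.1, true)) ?_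
        rw [eventually_curry_iff]
        filter_upwards [self_mem_nhdsWithin] with a ha
        filter_upwards [hσ.eventually (gt_mem_nhds (show (s : ℝ) < a from ha))] with i hi
        exact le_of_splitReal_lt hi
      · exact Tendsto.curry_nhds (g := fun a (q : I × ι) => (g q.2).toFun a)
          (fun a => (hH a).comp t2) (hleft s)
      · exact (Tendsto.curry_nhds (g := fun a i => (g i).toFun a) hH (hright s)).comp t1
  · rw [f.left_eq_of_notMem_interior hs, hfend s hs,
      tendsto_nhds_unique hx (tendsto_split_of_endpoint (hend s hs) hg (hH s) hτ),
      tendsto_nhds_unique hy (tendsto_split_of_endpoint (hend s hs) hg (hH s) hσ)]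
    exact ⟨B.left_mem _ _, B.left_mem _ _⟩

/-- Every real point of the filled-in graph of the limit is a limit of points of the filled-in
graphs. -/
theorem tendsto_infEDist_filledGraph_point (hB : B.IsCompatible)
    {W : Ultrafilter κ} {g : κ → Cadlag I X} {H : I → X} {f : Cadlag I X}
    (hH : ∀ t, Tendsto (fun k => (g k).toFun t) W (𝓝 (H t)))
    (hleft : ∀ s, Tendsto H (𝓝[<] s) (𝓝 (f.left s)))
    (hright : ∀ s, Tendsto H (𝓝[>] s) (𝓝 (f.toFun s)))
    (hfend : ∀ s : I, (s : ℝ) ∉ interior I → f.toFun s = H s)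
    (hlim : ∀ V : Ultrafilter (I × I × κ), Tendsto (fun p : I × I × κ => p.2.2) V W →
      B.SplitLimit V (fun p => g p.2.2) f)
    {s : I} {y : X} (hy : y ∈ B.seg (f.left s) (f.toFun s)) :
    Tendsto (fun k => Metric.infEDist (Squeezed.point y (s : ℝ)) (B.filledGraph (g k))) W
      (𝓝 0) := by
  by_cases hs : (s : ℝ) ∈ interior I
  swap
  · rw [f.left_eq_of_notMem_interior hs, seg_self, mem_singleton_iff, hfend s hs] at hy
    have h1 := Squeezed.tendsto_point (hH s) (tendsto_const_nhds (x := (s : ℝ)))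
    rw [tendsto_iff_edist_tendsto_0, ← hy] at h1
    refine tendsto_of_tendsto_of_tendsto_of_le_of_le tendsto_const_nhds h1
      (fun _ => zero_le) fun k => ?_
    dsimp only
    rw [edist_comm]
    exact Metric.infEDist_le_edist_of_mem
      (B.split_mem_filledGraph (g k) (toLex (s, true)))
  by_contra hcon
  obtain ⟨ε, hε, W', hW', hbad⟩ := exists_ultrafilter_of_not_tendsto_zero hcon
  have hmin : ¬ IsMin s := fun h => notMem_interior_of_isMin h hs
  have hmax : ¬ IsMax s := fun h => notMem_interior_of_isMax h hs
  have nl : (𝓝[<] s).NeBot := nhdsLT_neBot_of_exists_lt (not_isMin_iff.1 hmin)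
  have nr : (𝓝[>] s).NeBot := nhdsGT_neBot_of_exists_gt (not_isMax_iff.1 hmax)
  have n1 := curry_neBot (𝓝[>] s) (W' : Filter κ)
  have n2 := curry_neBot (𝓝[<] s) ((𝓝[>] s).curry (W' : Filter κ))
  have t1 := tendsto_snd_curry (𝓝[<] s) ((𝓝[>] s).curry (W' : Filter κ))
  have t2 := tendsto_snd_curry (𝓝[>] s) (W' : Filter κ)
  have t3 := t2.comp t1
  -- Along `V`, times `u < s < v` tend to `s` while `g k` tends to `f(s-)` at `u` and to `f(s+)` at
  -- `v`. The crossing time depends on all of `u`, `v`, `k`, which is why `hlim` concerns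
  -- ultrafilters on triples.
  let V := Ultrafilter.of ((𝓝[<] s).curry ((𝓝[>] s).curry (W' : Filter κ)))
  have hV : (V : Filter (I × I × κ)) ≤ (𝓝[<] s).curry ((𝓝[>] s).curry (W' : Filter κ)) :=
    Ultrafilter.of_le _
  have huL : Tendsto (fun p : I × I × κ => (g p.2.2).toFun p.1) V (𝓝 (f.left s)) :=
    (Tendsto.curry_nhds (g := fun a (q : I × κ) => (g q.2).toFun a)
      (fun a => ((hH a).mono_left hW').comp t2) (hleft s)).mono_left hV
  have hvR : Tendsto (fun p : I × I × κ => (g p.2.2).toFun p.2.1) V (𝓝 (f.toFun s)) :=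
    ((Tendsto.curry_nhds (g := fun a k => (g k).toFun a)
      (fun a => (hH a).mono_left hW') (hright s)).comp t1).mono_left hV
  have hu : Tendsto (fun p : I × I × κ => p.1) V (𝓝[<] s) :=
    (tendsto_fst_curry _ _).mono_left hV
  have hv : Tendsto (fun p : I × I × κ => p.2.1) V (𝓝[>] s) :=
    ((tendsto_fst_curry _ _).comp t1).mono_left hV
  have huv : ∀ᶠ p in (V : Filter (I × I × κ)), p.1 ≤ p.2.1 := by
    filter_upwards [hu self_mem_nhdsWithin, hv self_mem_nhdsWithin] with p h1 h2
    exact (lt_trans (show p.1 < s from h1) h2).le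
  let A := B.seg (f.left s) y
  let A' := B.seg y (f.toFun s)
  have hA : IsClosed A := (hB.isCompact_seg _ _).isClosed
  have hA' : IsClosed A' := (hB.isCompact_seg _ _).isClosed
  have hAne : A.Nonempty := ⟨_, B.left_mem _ _⟩
  have hAne' : A'.Nonempty := ⟨_, B.left_mem _ _⟩
  -- On the limit segment, which is the union of `A` and `A'`, the sign of `ψ` tells the part before
  -- `y` from the part after it.
  let ψ : X → ℝ := fun z => Metric.infDist z A - Metric.infDist z A'
  have hψ : Continuous ψ := (Metric.continuous_infDist_pt _).sub (Metric.continuous_infDist_pt _)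
  have : Nonempty I := ⟨s⟩
  obtain ⟨r, hr⟩ := (huv.mono fun p hp => (g p.2.2).exists_crossing hψ hp).choice
  have hrs : Tendsto (fun p => (r p : ℝ)) V (𝓝 (s : ℝ)) := by
    have hval := continuous_subtype_val.tendsto s
    refine tendsto_of_tendsto_of_tendsto_of_le_of_le' (hval.comp (hu.mono_right nhdsWithin_le_nhds))
      (hval.comp (hv.mono_right nhdsWithin_le_nhds)) ?_ ?_
    · filter_upwards [hr] with p hp using hp.1
    · filter_upwards [hr] with p hp using hp.2.1
  obtain ⟨a, b, ha, hb, hab, hbR⟩ := hlim V ((t3.mono_left hV).mono_right hW')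
    (fun p => toLex (r p, false)) (fun p => toLex (r p, true)) s
    (Eventually.of_forall fun p => toLex_false_le_toLex_true _) hrs hrs
  have hunion : ∀ z ∈ B.seg (f.left s) (f.toFun s), z ∈ A ∨ z ∈ A' := fun z hz => by
    rw [← B.union_eq _ y _ hy] at hz
    exact hz
  have hge : ∀ z ∈ B.seg (f.left s) (f.toFun s), 0 ≤ ψ z → z ∈ A' := fun z hz h0 => by
    rcases hunion z hz with h | h
    · exact mem_of_infDist_le hA' hAne' h (sub_nonneg.1 h0)
    · exact h
  have hle : ∀ z ∈ B.seg (f.left s) (f.toFun s), ψ z ≤ 0 → z ∈ A := fun z hz h0 => by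
    rcases hunion z hz with h | h
    · exact h
    · exact mem_of_infDist_le hA hAne h (sub_nonpos.1 h0)
  have hbA' : b ∈ A' := by
    rcases Ultrafilter.eventually_or.1 (hr.mono fun p hp => hp.2.2.1) with h | h
    · have : b = f.toFun s := by
        refine tendsto_nhds_unique hb (hvR.congr' ?_)
        filter_upwards [h] with p hp
        rw [← hp]; rfl
      rw [this]
      exact B.right_mem _ _
    · exact hge b hbR (ge_of_tendsto ((hψ.tendsto _).comp hb) h)
  -- The limit `b` of the right values lies in `A'`. Either the limit `a` of the left values lies in
  -- `A`, and then `a ≼ y ≼ b`, or `b` also lies in `A`, and then `b = y`.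
  have hyab : y ∈ B.seg a b := by
    have hor : b ∈ A ∨ a ∈ A := by
      rcases Ultrafilter.eventually_or.1 (hr.mono fun p hp => hp.2.2.2) with h | h
      · left
        have : b = f.left s := by
          refine tendsto_nhds_unique hb (huL.congr' ?_)
          filter_upwards [h] with p hp
          rw [← hp]; rfl
        rw [this]
        exact B.left_mem _ _
      · rcases Ultrafilter.eventually_or.1 h with h | h
        · exact Or.inr (hle a (seg_trans hab hbR) (le_of_tendsto ((hψ.tendsto _).comp ha) h))
        · exact Or.inl (hle b hbR (le_of_tendsto ((hψ.tendsto _).comp hb) h))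
    rcases hor with h | h
    · have h1 : b ∈ A ∩ A' := ⟨h, hbA'⟩
      rw [B.inter_eq _ _ _ hy, mem_singleton_iff] at h1
      rw [h1]
      exact B.right_mem _ _
    · exact mem_seg_of_le_of_le h (mem_seg_of_mem_seg_end hy hbA')
  obtain ⟨w, hw, hwy⟩ := hB.exists_mem_seg_tendsto ha hb hyab
  have hpt := tendsto_iff_edist_tendsto_0.1 (Squeezed.tendsto_point hwy hrs)
  obtain ⟨p, hp, hp'⟩ := ((hpt.eventually (gt_mem_nhds hε)).and
    ((t3.mono_left hV).eventually hbad)).exists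
  refine absurd hp'.le (not_le.2 (lt_of_le_of_lt ?_ hp))
  rw [edist_comm]
  exact Metric.infEDist_le_edist_of_mem (point_mem_filledGraph_iff.2 (hw p))

/-- The two points of a pair are approximated separately. Since each graph is totally ordered, the
wrong order along the ultrafilter would pass to the limit and, by antisymmetry, force the two points
to coincide; in that case one approximation serves for both. -/
theorem SplitLimit.exists_approx_orderedGraph (hI : IsClosed I) (hB : B.IsCompatible)
    {W : Ultrafilter κ} {g : κ → Cadlag I X} {f : Cadlag I X} (hlim : B.SplitLimit W g f)
    (happ : ∀ (s : I), ∀ y ∈ B.seg (f.left s) (f.toFun s),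
      Tendsto (fun k => Metric.infEDist (Squeezed.point y (s : ℝ)) (B.filledGraph (g k))) W (𝓝 0))
    {q : Squeezed X × Squeezed X} (hq : q ∈ B.orderedGraph f) :
    ∃ z : κ → Squeezed X × Squeezed X,
      (∀ᶠ k in (W : Filter κ), z k ∈ B.orderedGraph (g k)) ∧ Tendsto z W (𝓝 q) := by
  have happ' : ∀ p ∈ B.filledGraph f, ∃ z : κ → Squeezed X,
      (∀ k, z k ∈ B.filledGraph (g k)) ∧ Tendsto z W (𝓝 p) := by
    intro p hp
    refine exists_tendsto_of_infEDist_of_isCompact (fun k => isCompact_filledGraph hI hB (g k))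
      (fun k => ⟨_, B.negInf_mem_filledGraph _⟩) ?_
    rcases hp with ⟨s, y, hy, rfl⟩ | rfl | rfl
    · exact happ s y hy
    · exact tendsto_const_nhds.congr fun k =>
        (Metric.infEDist_zero_of_mem (B.negInf_mem_filledGraph (g k))).symm
    · exact tendsto_const_nhds.congr fun k =>
        (Metric.infEDist_zero_of_mem (B.posInf_mem_filledGraph (g k))).symm
  obtain ⟨a, b⟩ := q
  obtain ⟨x, hx, hxa⟩ := happ' a hq.1
  obtain ⟨y, hy, hyb⟩ := happ' b hq.2.1
  by_cases hab : a = b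
  · subst hab
    exact ⟨fun k => (x k, x k), Eventually.of_forall fun k => ⟨hx k, hx k, Or.inr (Or.inl rfl)⟩,
      hxa.prodMk_nhds hxa⟩
  refine ⟨fun k => (x k, y k), ?_, hxa.prodMk_nhds hyb⟩
  rcases Ultrafilter.eventually_or.1 (Eventually.of_forall (f := (W : Filter κ)) fun k =>
    graphLE_total (hx k) (hy k)) with h | h
  · filter_upwards [h] with k hk using ⟨hx k, hy k, hk⟩
  · exact absurd (graphLE_antisymm hq.2.2
      (hlim.graphLE_of_tendsto hB hy hx h hq.2.1 hq.1 hyb hxa)) hab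

/-- If the distance stays above `ε`, the ultrafilter selects one direction. Far points of the
varying graphs contradict `SplitLimit`; far points of the graph of `f` converge by compactness to a
point that can be approximated. -/
theorem tendsto_hausdorffEDist_orderedGraph (hI : IsClosed I) (hB : B.IsCompatible)
    {U : Ultrafilter κ} {g : κ → Cadlag I X} {f : Cadlag I X}
    (hlim : ∀ W : Ultrafilter κ, (W : Filter κ) ≤ U → B.SplitLimit W g f)
    (happ : ∀ (s : I), ∀ y ∈ B.seg (f.left s) (f.toFun s),
      Tendsto (fun k => Metric.infEDist (Squeezed.point y (s : ℝ)) (B.filledGraph (g k))) U (𝓝 0)) :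
    Tendsto (fun k => Metric.hausdorffEDist (B.orderedGraph (g k)) (B.orderedGraph f)) U (𝓝 0) := by
  by_contra hcon
  obtain ⟨ε, hε, W, hW, hbad⟩ := exists_ultrafilter_of_not_tendsto_zero hcon
  have hbad' : ∀ᶠ k in (W : Filter κ),
      (∃ p ∈ B.orderedGraph (g k), ε < Metric.infEDist p (B.orderedGraph f)) ∨
      ∃ p ∈ B.orderedGraph f, ε < Metric.infEDist p (B.orderedGraph (g k)) := by
    filter_upwards [hbad] with k hk
    by_contra hcon
    push Not at hcon
    exact absurd (Metric.hausdorffEDist_le_of_infEDist hcon.1 hcon.2) (not_le.2 hk)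
  have : Nonempty (Squeezed X) := ⟨.negInf⟩
  classical
  rcases Ultrafilter.eventually_or.1 hbad' with h | h
  · obtain ⟨p, hp⟩ := h.choice
    obtain ⟨q, hq, hpq⟩ := (hlim W hW).exists_tendsto_orderedGraph hI hB
      (p := fun k => if p k ∈ B.orderedGraph (g k) then p k else (.negInf, .negInf)) (fun k => by
        split_ifs with h
        · exact h
        · exact B.negInf_mem_orderedGraph _)
    have hpq' := tendsto_iff_edist_tendsto_0.1 hpq
    obtain ⟨k, hk, hk'⟩ := ((hpq'.eventually (gt_mem_nhds hε)).and hp).exists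
    rw [if_pos hk'.1] at hk
    exact absurd (hk'.2.trans_le (Metric.infEDist_le_edist_of_mem hq)) hk.not_gt
  · obtain ⟨p, hp⟩ := h.choice
    obtain ⟨q, hq, hpq⟩ := isCompact_iff_ultrafilter_le_nhds'.1 (isCompact_orderedGraph hI hB f)
      (W.map p) (hp.mono fun k hk => hk.1)
    have hpq' : Tendsto p W (𝓝 q) := hpq
    obtain ⟨z, hz, hzq⟩ := (hlim W hW).exists_approx_orderedGraph hI hB
      (fun s y hy => (happ s y hy).mono_left hW) hq
    have hd := hpq'.edist hzq
    rw [edist_self] at hd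
    obtain ⟨k, hk, hk', hk''⟩ := ((hd.eventually (gt_mem_nhds hε)).and (hp.and hz)).exists
    exact absurd (hk'.2.trans_le (Metric.infEDist_le_edist_of_mem hk'')) hk.not_gt

theorem exists_skorohod_limit (hI : IsClosed I) (hB : B.IsCompatible) (hcc : CompactContainment F)
    (hmod : ∀ T : ℝ, 0 < T →
      Tendsto (fun δ : ℝ => ⨆ f ∈ F, B.skorohodModulus T δ f) (𝓝[>] 0) (𝓝 0))
    (hend : ∀ t : I, (t : ℝ) ∉ interior I →
      Tendsto (fun δ : ℝ => ⨆ f ∈ F, ⨆ (s : I) (_ : |(s : ℝ) - (t : ℝ)| ≤ δ),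
        edist (f.toFun s) (f.toFun t)) (𝓝[>] 0) (𝓝 0))
    {U : Ultrafilter κ} {g : κ → Cadlag I X} (hg : ∀ᶠ k in (U : Filter κ), g k ∈ F) :
    ∃ f : Cadlag I X,
      Tendsto (fun k => Metric.hausdorffEDist (B.orderedGraph (g k)) (B.orderedGraph f)) U
        (𝓝 0) := by
  choose H hH using fun t : I => hcc.exists_tendsto_split hg (τ := fun _ => toLex (t, true))
    (tendsto_const_nhds (x := (t : ℝ)))
  obtain ⟨f, hleft, hright, hfend⟩ := exists_cadlag_of_pointwise_limit hB hcc hmod hend hg hH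
  -- Reindexing is allowed so that the same fact serves on `κ` and on the triples of the crossing
  -- argument.
  have hlim : ∀ {ι : Type _} (V : Ultrafilter ι) (φ : ι → κ), Tendsto φ V U →
      B.SplitLimit V (fun i => g (φ i)) f := fun V φ hφ =>
    splitLimit_of_pointwise_limit hB hcc hmod hend (hφ.eventually hg)
      (fun t => (hH t).comp hφ) hleft hright hfend
  refine ⟨f, tendsto_hausdorffEDist_orderedGraph hI hB (fun W hW => hlim W id hW) ?_⟩
  intro s y hy
  exact tendsto_infEDist_filledGraph_point hB hH hleft hright hfend
    (fun V hV => hlim V _ hV) hy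

theorem isPrecompact_of_conditions (hI : IsClosed I) (hB : B.IsCompatible)
    (hcc : CompactContainment F)
    (hmod : ∀ T : ℝ, 0 < T →
      Tendsto (fun δ : ℝ => ⨆ f ∈ F, B.skorohodModulus T δ f) (𝓝[>] 0) (𝓝 0))
    (hend : ∀ t : I, (t : ℝ) ∉ interior I →
      Tendsto (fun δ : ℝ => ⨆ f ∈ F, ⨆ (s : I) (_ : |(s : ℝ) - (t : ℝ)| ≤ δ),
        edist (f.toFun s) (f.toFun t)) (𝓝[>] 0) (𝓝 0)) : B.IsPrecompact F := by
  let _ := B.skorohodMetric I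
  change IsCompact (closure F)
  refine IsSeqCompact.isCompact fun u hu => ?_
  -- The conditions concern `F` and not its closure, so `u` is replaced by a sequence in `F` at
  -- vanishing distance. A limit along `hyperfilter ℕ` is a cluster point of the sequence, and hence
  -- a subsequential limit.
  choose v hvF hv using fun n : ℕ => EMetric.mem_closure_iff.1 (hu n) ((n : ℝ≥0∞) + 1)⁻¹ (by simp)
  obtain ⟨f, hf⟩ := exists_skorohod_limit hI hB hcc hmod hend (U := hyperfilter ℕ) (g := v)
    (Eventually.of_forall hvF)
  have hle : (hyperfilter ℕ : Filter ℕ) ≤ atTop := Nat.hyperfilter_le_atTop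
  have huf : Tendsto u (hyperfilter ℕ) (𝓝 f) := by
    rw [tendsto_iff_edist_tendsto_0]
    have h1 : Tendsto (fun n : ℕ => ((n : ℝ≥0∞) + 1)⁻¹) (hyperfilter ℕ) (𝓝 0) := by
      have := (ENNReal.tendsto_inv_nat_nhds_zero.comp (tendsto_add_atTop_nat 1)).mono_left hle
      simpa [Function.comp_def] using this
    have h2 := h1.add hf
    rw [add_zero] at h2
    refine tendsto_of_tendsto_of_tendsto_of_le_of_le tendsto_const_nhds h2 (fun _ => zero_le)
      fun n => ?_
    exact (edist_triangle _ (v n) _).trans (add_le_add (hv n).le le_rfl)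
  refine ⟨f, isClosed_closure.mem_of_tendsto huf (Eventually.of_forall hu), ?_⟩
  exact (mapClusterPt_iff_ultrafilter.2 ⟨_, hle, huf⟩).tendsto_subseq

end Betweenness

theorem theorem3p8 {X : Type*} [MetricSpace X] (B : Betweenness X) (hB : B.IsCompatible)
    (I : Set ℝ) (hIclosed : IsClosed I) (hIinterval : I.OrdConnected) (hIlength : I.Nontrivial)
    (F : Set (Cadlag I X)) :
    B.IsPrecompact F ↔
      (CompactContainment F ∧
        (∀ T : ℝ, 0 < T →
          Tendsto (fun δ : ℝ => ⨆ f ∈ F, B.skorohodModulus T δ f) (𝓝[>] 0) (𝓝 0)) ∧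
        (∀ t : I, (t : ℝ) ∉ interior I →
          Tendsto (fun δ : ℝ => ⨆ f ∈ F, ⨆ (s : I) (_ : |(s : ℝ) - (t : ℝ)| ≤ δ),
            edist (f.toFun s) (f.toFun t)) (𝓝[>] 0) (𝓝 0))) :=
  ⟨fun hF => ⟨hF.compactContainment hIclosed hB,
    fun T _ => hF.tendsto_skorohodModulus hIclosed hB T,
    fun _ ht => hF.tendsto_endpoint hIclosed hB ht⟩,
    fun ⟨hcc, hmod, hend⟩ => Betweenness.isPrecompact_of_conditions hIclosed hB hcc hmod hend⟩
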